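/- Let $q$ be a power of a prime $p$, let $\omega=e^{2\pi i/p}$, and let $\mathcal E_n=\{\omega^iX(\mathbf a)Z(\mathbf b):i\in\mathbb F_p,\ \mathbf a,\mathbf b\in\mathbb F_q^n\}$ be the generalized Pauli group on $(\mathbb C^q)^{\otimes n}$, where $X(a)|j\rangle=|j+a\rangle$ and $Z(b)|j\rangle=\omega^{\mathrm{tr}(bj)}|j\rangle$ for $a,b,j\in\mathbb F_q$, and $\mathrm{tr}$ is the trace from $\mathbb F_q$ to $\mathbb F_p$. For a subgroup $\mathcal A\le\mathcal E_n$ write $\tau(\mathcal A)=\{(\mathbf a|\mathbf b):\omega^iX(\mathbf a)Z(\mathbf b)\in\mathcal A\text{ for some }i\}$, and let $\perp$ denote the dual in $\mathbb F_q^{2n}$ for the form $\mathrm{tr}(\mathbf a\cdot\mathbf b'-\mathbf b\cdot\mathbf a')$. Call $\mathcal A$ isotropic if $\tau(\mathcal A)\subseteq\tau(\mathcal A)^\perp$, and an entanglement subgroup if $\tau(\mathcal A)\cap\tau(\mathcal A)^\perp=\{0\}$. For subgroups $\mathcal A\le\mathcal B$ of $\mathcal E_n$ let $d(\mathcal B,\mathcal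 A)$ be the minimum weight of a Pauli operator that commutes with all of $\mathcal B$ and is not a phase times an element of $\mathcal A$ ($\infty$ if there is none). Let $\mathcal S\le\mathcal E_n$ be generated by two subgroups $\mathcal S_I$ and $\mathcal S_E$ that commute with each other and intersect only in phases (that is, $\mathcal S=\mathcal S_I\times\mathcal S_E$ modulo phases), where $\mathcal S_I$ is isotropic with $|\tau(\mathcal S_I)|=q^l$ and $\mathcal S_E$ is an entanglement subgroup with $|\tau(\mathcal S_E)|=q^{2c}$. Let $\mathcal S^b\le\mathcal E_m$ be abelian with $\omega I\notin\mathcal S^b$ and $|\mathcal S^b|=q^{m-k_b}$, where $0\le k_b\le m$. Suppose that $k_b\ge c$. Then $c+l\le n$, and with $k=n-c-l$, $d_{ea}=d(\mathcal S,\mathcal S_I)$ and $d_b=d(\mathcal S^b,\mathcal S^b)$ there is a combination entanglement-assisted code with noisy ebits (EAQECC-Ne) $[[n,k,d_{ea};c]]_q+[[m,k_b,d_b]]_q$ described by $(\mathcal S,\mathcal S^b)$. That is, the following exist. 1. An entanglement-assisted code $Q^{ea}=[[n,k,d_{ea};c]]_q$ with EA-stabilizer $\mathcal S$: a subspace of $(\mathbb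 C^q)^{\otimes(n+c)}$ that consists of the states which the sender produces by applying a fixed isometry $(\mathbb C^q)^{\otimes(k+c)}\to(\mathbb C^q)^{\otimes n}$ to $k$ data qudits and to her halves of $c$ maximally entangled pairs; that is a joint eigenspace of an abelian subgroup $\tilde{\mathcal S}\le\mathcal E_{n+c}$ whose restriction to the first $n$ qudits maps $\tau(\tilde{\mathcal S})$ bijectively onto $\tau(\mathcal S)$; and whose minimum distance (the least weight of an undetectable Pauli error) against errors on the $n$ qudits of the sender is $d_{ea}$. 2. The code $Q^b=[[m,k_b,d_b]]_q$ stabilized by $\mathcal S^b$: the common fixed space of $\mathcal S^b$ in $(\mathbb C^q)^{\otimes m}$, which has dimension $q^{k_b}$ and minimum distance $d_b$. 3. An isometry $V:(\mathbb C^q)^{\otimes c}\to(\mathbb C^q)^{\otimes m}$ with image in $Q^b$, which encodes the receiver's $c$ halves of the entangled pairs, such that the combined code $(I\otimes V)Q^{ea}\subseteq(\mathbb C^q)^{\otimes(n+m)}$ detects every Pauli error $E_A\otimes E_B$ with $\mathrm{wt}(E_A)<d_{ea}$ on the sender's $n$ qudits and $\mathrm{wt}(E_B)<d_b$ on the receiver's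 $m$ qudits. Here a code with orthogonal projection $P$ detects $E$ if $PEP=\lambda P$ for some $\lambda\in\mathbb C$. -/

import Mathlib

open scoped Matrix

noncomputable section

namespace QCode

/-! Qudits are indexed by a finite type `ι`; the computational basis of a register is `ι → F`, its
states are functions `(ι → F) → ℂ`, and its operators are matrices. -/

/-- Operators on a register of qudits indexed by `ι`, each with basis states labelled by `F`. -/
abbrev Op (F ι : Type) : Type := Matrix (ι → F) (ι → F) ℂ

/-- State vectors of a register of qudits indexed by `ι`. -/
abbrev State (F ι : Type) : Type := (ι → F) → ℂ

/-- The primitive `p`-th root of unity `exp (2 π i / p)`. -/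
def omega (p : ℕ) : ℂ := Complex.exp (2 * Real.pi * Complex.I / p)

/-- `ω ^ t` for `t` in the prime field. -/
def omegaPow (p : ℕ) (t : ZMod p) : ℂ := omega p ^ t.val

/-- The one-qudit operator `X(a)|j⟩ = |j + a⟩`. -/
def shift {F : Type} [Field F] [DecidableEq F] (a : F) : Matrix F F ℂ :=
  Matrix.of fun i j => if i = j + a then 1 else 0

/-- The one-qudit operator `Z(b)|j⟩ = ω ^ tr(b j) |j⟩`. -/
def clock (p : ℕ) {F : Type} [Field F] [DecidableEq F] [Algebra (ZMod p) F] (b : F) :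
    Matrix F F ℂ :=
  Matrix.diagonal fun j => omegaPow p (Algebra.trace (ZMod p) F (b * j))

/-- The tensor product of one-qudit operators. -/
def tensor {F ι : Type} [Fintype ι] (M : ι → Matrix F F ℂ) : Op F ι :=
  Matrix.of fun x y => ∏ i, M i (x i) (y i)

/-- `X(𝐚) = X(a₁) ⊗ ⋯ ⊗ X(aₙ)`. -/
def opX {F ι : Type} [Field F] [DecidableEq F] [Fintype ι] (a : ι → F) : Op F ι :=
  tensor fun i => shift (a i)

/-- `Z(𝐛) = Z(b₁) ⊗ ⋯ ⊗ Z(bₙ)`. -/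
def opZ (p : ℕ) {F ι : Type} [Field F] [DecidableEq F] [Algebra (ZMod p) F] [Fintype ι]
    (b : ι → F) : Op F ι :=
  tensor fun i => clock p (b i)

/-- The error operator `X(𝐚) Z(𝐛)`. -/
def pauli (p : ℕ) {F ι : Type} [Field F] [Fintype F] [DecidableEq F] [Algebra (ZMod p) F]
    [Fintype ι] [DecidableEq ι] (a b : ι → F) : Op F ι :=
  opX a * opZ p b

/-- The weight of `ω ^ i X(𝐚) Z(𝐛)`: the number of qudits on which it is not a scalar. -/
def wt {F ι : Type} [Field F] [DecidableEq F] [Fintype ι] (a b : ι → F) : ℕ :=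
  (Finset.univ.filter fun i => a i ≠ 0 ∨ b i ≠ 0).card

section GroupLaws

theorem omega_pow_self {p : ℕ} [Fact p.Prime] : omega p ^ p = 1 := by
  have hp : (p : ℂ) ≠ 0 := by exact_mod_cast (Fact.out : p.Prime).ne_zero
  rw [omega, ← Complex.exp_nat_mul, mul_div_cancel₀ _ hp, Complex.exp_two_pi_mul_I]

theorem omegaPow_add {p : ℕ} [Fact p.Prime] (s t : ZMod p) :
    omegaPow p (s + t) = omegaPow p s * omegaPow p t := by
  rw [omegaPow, omegaPow, omegaPow, ← pow_add, ZMod.val_add,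
    ← pow_eq_pow_mod (s.val + t.val) (omega_pow_self (p := p))]

theorem tensor_mul {F ι : Type} [Fintype F] [Fintype ι] [DecidableEq ι]
    (M N : ι → Matrix F F ℂ) : (tensor M * tensor N : Op F ι) = tensor fun i => M i * N i := by
  ext x y
  simp only [tensor, Matrix.mul_apply, Matrix.of_apply, ← Finset.prod_mul_distrib]
  rw [Finset.prod_univ_sum]
  simp [Fintype.piFinset_univ]

theorem tensor_smul {F ι : Type} [Fintype ι] (c : ι → ℂ) (M : ι → Matrix F F ℂ) :
    (tensor fun i => c i • M i : Op F ι) = (∏ i, c i) • tensor M := by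
  ext x y
  simp [tensor, Finset.prod_mul_distrib]

variable {p : ℕ} [Fact p.Prime] {F ι : Type} [Field F] [Fintype F] [DecidableEq F]
  [Algebra (ZMod p) F] [Fintype ι] [DecidableEq ι]

theorem shift_mul (a a' : F) : shift a * shift a' = shift (a + a') := by
  ext i j
  simp [shift, Matrix.mul_apply, add_comm, add_left_comm]

theorem clock_mul (b b' : F) : clock p b * clock p b' = clock p (b + b') := by
  simp [clock, Matrix.diagonal_mul_diagonal, add_mul, omegaPow_add]

theorem clock_mul_shift (a b : F) :
    clock p b * shift a = omegaPow p (Algebra.trace (ZMod p) F (b * a)) • (shift a * clock p b) := by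
  ext i j
  by_cases h : i = j + a
  · subst h
    simp [shift, clock, mul_add, omegaPow_add, mul_comm]
  · simp [shift, clock, h]

theorem opX_mul (a a' : ι → F) : opX a * opX a' = opX (a + a') := by
  simp [opX, tensor_mul, shift_mul]

theorem opZ_mul (b b' : ι → F) : opZ p b * opZ p b' = opZ p (b + b') := by
  simp [opZ, tensor_mul, clock_mul]

theorem opZ_mul_opX (a b : ι → F) : ∃ k : ℕ, opZ p b * opX a = omega p ^ k • (opX a * opZ p b) := by
  refine ⟨∑ i, (Algebra.trace (ZMod p) F (b i * a i)).val, ?_⟩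
  simp only [opX, opZ, tensor_mul, clock_mul_shift, tensor_smul, ← Finset.prod_pow_eq_pow_sum,
    omegaPow]

theorem pauli_zero : (pauli p 0 0 : Op F ι) = 1 := by
  ext x y
  simp only [pauli, opX, opZ, tensor_mul]
  have h : (shift (0 : F) * clock p (0 : F)) = 1 := by
    ext i j
    simp [shift, clock, omegaPow, Matrix.one_apply]
  simp only [Pi.zero_apply, h, tensor, Matrix.of_apply, Matrix.one_apply]
  by_cases hxy : x = y
  · simp [hxy]
  · obtain ⟨i, hi⟩ := Function.ne_iff.mp hxy
    rw [if_neg hxy]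
    exact Finset.prod_eq_zero (Finset.mem_univ i) (if_neg hi)

theorem pauli_mul (a b a' b' : ι → F) :
    ∃ k : ℕ, pauli p a b * pauli p a' b' = omega p ^ k • pauli p (a + a') (b + b') := by
  obtain ⟨k, hk⟩ := opZ_mul_opX (p := p) a' b
  refine ⟨k, ?_⟩
  calc pauli p a b * pauli p a' b' = opX a * (opZ p b * opX a') * opZ p b' := by
        simp only [pauli, Matrix.mul_assoc]
    _ = omega p ^ k • ((opX a * opX a') * (opZ p b * opZ p b')) := by
        rw [hk]; simp only [Matrix.mul_smul, Matrix.smul_mul, Matrix.mul_assoc]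
    _ = _ := by rw [opX_mul, opZ_mul, pauli]

end GroupLaws

/-- The generalized Pauli group `{ω ^ k X(𝐚) Z(𝐛)}` on the register `ι`. -/
def pauliGroup (p : ℕ) [Fact p.Prime] (F ι : Type) [Field F] [Fintype F] [DecidableEq F]
    [Algebra (ZMod p) F] [Fintype ι] [DecidableEq ι] : Subgroup (Op F ι)ˣ where
  carrier := {g | ∃ (k : ℕ) (a b : ι → F), (g : Op F ι) = omega p ^ k • pauli p a b}
  one_mem' := ⟨0, 0, 0, by simp [pauli_zero]⟩
  mul_mem' := by
    rintro g h ⟨k, a, b, hg⟩ ⟨k', a', b', hh⟩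
    obtain ⟨t, ht⟩ := pauli_mul (p := p) a b a' b'
    refine ⟨k + k' + t, a + a', b + b', ?_⟩
    rw [Units.val_mul, hg, hh, Matrix.smul_mul, Matrix.mul_smul, ht, smul_smul, smul_smul,
      ← pow_add, ← pow_add]
  inv_mem' := by
    rintro g ⟨k, a, b, hg⟩
    obtain ⟨t, ht⟩ := pauli_mul (p := p) a b (-a) (-b)
    refine ⟨(p - 1) * (k + t), -a, -b, ?_⟩
    apply Units.inv_eq_of_mul_eq_one_right
    have hp : 1 ≤ p := (Fact.out : p.Prime).one_le
    have e : k + t + (p - 1) * (k + t) = p * (k + t) := by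
      obtain ⟨r, rfl⟩ := Nat.exists_eq_add_of_le hp
      simp only [Nat.add_sub_cancel_left]
      ring
    rw [hg, Matrix.smul_mul, Matrix.mul_smul, ht, add_neg_cancel, add_neg_cancel, pauli_zero,
      smul_smul, smul_smul, ← pow_add, ← pow_add,
      show k + (p - 1) * (k + t) + t = k + t + (p - 1) * (k + t) by ring, e, pow_mul,
      omega_pow_self, one_pow, one_smul]

section Codes

variable (p : ℕ) {F ι κ : Type} [Field F] [Fintype F] [DecidableEq F]
  [Algebra (ZMod p) F] [Fintype ι] [DecidableEq ι] [Fintype κ] [DecidableEq κ]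

/-- The image of a group of Pauli operators under `τ(ω ^ k X(𝐚) Z(𝐛)) = (𝐚|𝐛)`, that is, the
group taken modulo phases. -/
def tau (A : Subgroup (Op F ι)ˣ) : Set ((ι → F) × (ι → F)) :=
  {v | ∃ g ∈ A, ∃ k : ℕ, (g : Op F ι) = omega p ^ k • pauli p v.1 v.2}

/-- The symplectic inner product `⟨(𝐚|𝐛), (𝐚'|𝐛')⟩ = 𝐚 ⬝ 𝐛' - 𝐛 ⬝ 𝐚'`. -/
def symp (v w : (ι → F) × (ι → F)) : F := v.1 ⬝ᵥ w.2 - v.2 ⬝ᵥ w.1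

/-- The dual for the form `tr ⟨v, w⟩`, which governs commutation of Pauli operators. For
`F`-linear subspaces it is the same as the dual for `⟨v, w⟩` itself. -/
def sympDual (T : Set ((ι → F) × (ι → F))) : Set ((ι → F) × (ι → F)) :=
  {v | ∀ w ∈ T, Algebra.trace (ZMod p) F (symp v w) = 0}

/-- Isotropic subgroups. -/
def IsIsotropic (A : Subgroup (Op F ι)ˣ) : Prop := tau p A ⊆ sympDual p (tau p A)

/-- Entanglement (symplectic) subgroups. -/
def IsEntanglement (A : Subgroup (Op F ι)ˣ) : Prop := tau p A ∩ sympDual p (tau p A) = {0}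

/-- `S = S_I × S_E`: the factors commute, generate `S`, and meet only in phases. -/
structure IsDirectProduct (S SI SE : Subgroup (Op F ι)ˣ) : Prop where
  sup_eq : SI ⊔ SE = S
  commute : ∀ g ∈ SI, ∀ h ∈ SE, g * h = h * g
  inter : tau p SI ∩ tau p SE = {0}

/-- The code `Q` detects the error `E`: `P E P = lam P` for the projection `P` onto `Q`. -/
def Detects (Q : Submodule ℂ (State F ι)) (E : Op F ι) : Prop :=
  ∃ lam : ℂ, ∀ u ∈ Q, ∀ v ∈ Q, star u ⬝ᵥ (E *ᵥ v) = lam * (star u ⬝ᵥ v)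

/-- The minimum distance of a code: the least weight of an undetectable Pauli error (`⊤` if there
is none). -/
def minDist (Q : Submodule ℂ (State F ι)) : ℕ∞ :=
  ⨅ (a : ι → F) (b : ι → F) (_ : ¬ Detects Q (pauli p a b)), (wt a b : ℕ∞)

/-- The minimum distance when errors occur only on the part `ι` of the register `ι ⊕ κ`. -/
def minDistLeft (Q : Submodule ℂ (State F (ι ⊕ κ))) : ℕ∞ :=
  ⨅ (a : ι → F) (b : ι → F)
    (_ : ¬ Detects Q (pauli p (Sum.elim a (0 : κ → F)) (Sum.elim b (0 : κ → F)))), (wt a b : ℕ∞)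

/-- `min {wt g : g ∈ N(S) \ A}` over Pauli operators `g` taken modulo phases, where `N(S)` consists
of those that commute with `S` (`⊤` if there is none). -/
def normDist (S A : Subgroup (Op F ι)ˣ) : ℕ∞ :=
  ⨅ (a : ι → F) (b : ι → F)
    (_ : (∀ g ∈ S, pauli p a b * (g : Op F ι) = (g : Op F ι) * pauli p a b) ∧ (a, b) ∉ tau p A),
    (wt a b : ℕ∞)

/-- The code stabilized by a group of operators. -/
def stabCode (A : Subgroup (Op F ι)ˣ) : Submodule ℂ (State F ι) where
  carrier := {v | ∀ g ∈ A, (g : Op F ι) *ᵥ v = v}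
  add_mem' := by
    intro u v hu hv g hg
    rw [Matrix.mulVec_add, hu g hg, hv g hg]
  zero_mem' := fun g _ => Matrix.mulVec_zero _
  smul_mem' := by
    intro r v hv g hg
    rw [Matrix.mulVec_smul, hv g hg]

/-- `Q` is an `[[m, k, d]]_q` code. -/
structure IsQECC (m k : ℕ) (d : ℕ∞) (Q : Submodule ℂ (State F (Fin m))) : Prop where
  dim : Module.finrank ℂ Q = Fintype.card F ^ k
  dist : minDist p Q = d

/-- The state `q ^ (-c/2) ∑ |x⟩|x⟩` of `c` maximally entangled pairs. -/
def ebits (F : Type) [Fintype F] [DecidableEq F] (c : ℕ) (x y : Fin c → F) : ℂ :=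
  if x = y then ((Real.sqrt ((Fintype.card F : ℝ) ^ c) : ℝ) : ℂ)⁻¹ else 0

/-- The sender applies `W` to a `k`-qudit state `ψ` and to her halves of `c` maximally entangled
pairs; the result is a state of her `n` qudits and the `c` qudits of the receiver. -/
def eaEncode {n k c : ℕ} (W : Matrix (Fin n → F) ((Fin k → F) × (Fin c → F)) ℂ) :
    State F (Fin k) →ₗ[ℂ] State F (Fin n ⊕ Fin c) where
  toFun ψ := fun z => ∑ i : Fin k → F, ∑ x : Fin c → F,
    W (z ∘ Sum.inl) (i, x) * (ψ i * ebits F c x (z ∘ Sum.inr))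
  map_add' u v := by
    funext z
    simp [add_mul, mul_add, Finset.sum_add_distrib]
  map_smul' r v := by
    funext z
    simp only [Pi.smul_apply, smul_eq_mul, RingHom.id_apply, Finset.mul_sum]
    refine Finset.sum_congr rfl fun i _ => Finset.sum_congr rfl fun x _ => ?_
    ring

/-- `Q` is an `[[n, k, d; c]]_q` code: the image of an isometric encoding by the sender, with
distance `d` against errors on her `n` qudits. -/
structure IsEAQECC (n k : ℕ) (d : ℕ∞) (c : ℕ) (Q : Submodule ℂ (State F (Fin n ⊕ Fin c))) :
    Prop where
  encoding : ∃ W : Matrix (Fin n → F) ((Fin k → F) × (Fin c → F)) ℂ,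
    Wᴴ * W = 1 ∧ Q = LinearMap.range (eaEncode W)
  dist : minDistLeft p Q = d

/-- `S` is an EA-stabilizer of `Q`: it extends, one-to-one modulo phases, to an abelian group `T`
of Pauli operators on the `ι` qudits and the `κ` halves of entangled pairs, and `Q` is a joint
eigenspace of `T`. -/
def EAStabilizes [Fact p.Prime] (S : Subgroup (Op F ι)ˣ)
    (Q : Submodule ℂ (State F (ι ⊕ κ))) : Prop :=
  ∃ T : Subgroup (Op F (ι ⊕ κ))ˣ, T ≤ pauliGroup p F (ι ⊕ κ) ∧
    (∀ g ∈ T, ∀ h ∈ T, g * h = h * g) ∧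
    Set.BijOn (fun v => (v.1 ∘ Sum.inl, v.2 ∘ Sum.inl)) (tau p T) (tau p S) ∧
    ∃ χ : T →* ℂˣ, ∀ v : State F (ι ⊕ κ),
      v ∈ Q ↔ ∀ g : T, ((g : (Op F (ι ⊕ κ))ˣ) : Op F (ι ⊕ κ)) *ᵥ v = (χ g : ℂ) • v

/-- The operator `I ⊗ V` that encodes the second part of the register `ι ⊕ κ` by `V`. -/
def encodeRight {μ : Type} (V : Matrix (μ → F) (κ → F) ℂ) :
    State F (ι ⊕ κ) →ₗ[ℂ] State F (ι ⊕ μ) where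
  toFun ψ := fun z => ∑ y : κ → F, V (z ∘ Sum.inr) y * ψ (Sum.elim (z ∘ Sum.inl) y)
  map_add' u v := by
    funext z
    simp [mul_add, Finset.sum_add_distrib]
  map_smul' r v := by
    funext z
    simp only [Pi.smul_apply, smul_eq_mul, RingHom.id_apply, Finset.mul_sum]
    refine Finset.sum_congr rfl fun y _ => ?_
    ring

/-- `QC` is a combination `[[n, k, dea; c]]_q + [[m, kb, db]]_q` of `Qea` and `Qb` described by the
pair `(S, Sb)`: the `c` halves of entangled pairs held by the receiver are encoded into `Qb`, and
the resulting code detects any error of weight less than `dea` on the sender's qudits together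
with any error of weight less than `db` on the receiver's qudits. -/
structure IsCombination [Fact p.Prime] {n m c : ℕ} (S : Subgroup (Op F (Fin n))ˣ)
    (Sb : Subgroup (Op F (Fin m))ˣ) (k : ℕ) (dea : ℕ∞) (kb : ℕ) (db : ℕ∞)
    (Qea : Submodule ℂ (State F (Fin n ⊕ Fin c))) (Qb : Submodule ℂ (State F (Fin m)))
    (QC : Submodule ℂ (State F (Fin n ⊕ Fin m))) : Prop where
  isEAQECC : IsEAQECC p n k dea c Qea
  eaStabilizes : EAStabilizes p S Qea
  isQECC : IsQECC p m kb db Qb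
  stabilizes : Qb = stabCode Sb
  le : c ≤ kb
  encoding : ∃ V : Matrix (Fin m → F) (Fin c → F) ℂ,
    Vᴴ * V = 1 ∧ (∀ y, V *ᵥ y ∈ Qb) ∧ QC = Qea.map (encodeRight V)
  detects : ∀ (a b : Fin n → F) (a' b' : Fin m → F), (wt a b : ℕ∞) < dea → (wt a' b' : ℕ∞) < db →
    Detects QC (pauli p (Sum.elim a a') (Sum.elim b b'))

end Codes

end QCode
end

/-!
Everything is read off from phase space `F ^ ι × F ^ ι`, a vector space over the prime field with
the nondegenerate alternating form `tr ⟨v, w⟩` (`traceForm`), which decides whether Pauli operators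
commute.

*Joint eigenspaces.* Let `T` be a group of Pauli operators and `χ` a character of `T` that takes
each phase to itself. The projection onto the joint eigenspace `Q` of `T` for `χ` is the average
over `v ∈ τ(T)` of the normalized operators `χ(g)⁻¹ g`, with `g ∈ T` over `v`
(`exists_projection`). A Pauli operator other than a phase has trace zero, so
`dim Q * |τ(T)| = q ^ |ι|` (`finrank_mul_card`), and a Pauli operator that commutes with `T` but
lies outside `τ(T)` acts on `Q` with trace zero, hence not as a scalar. One that does not commute
with `T` maps `Q` into its orthogonal complement. Thus the undetectable errors are exactly those in
the normalizer and outside `τ(T)` (`detects_iff`). For the trivial character of `Sb` this gives the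
code of the receiver.

*The entanglement-assisted code.* `τ(S)` is the sum of its radical `τ(SI)` and of the symplectic
space `τ(SE)`, which has the same size as the phase space of `c` qudits. Symplectic spaces of equal
dimension are isometric (`exists_symplectic_embedding`), so there is an anti-isometry `φ` of
`τ(SE)` onto that phase space, and the vectors `(v + w, φ w)` form an isotropic subspace over
`τ(S)` (`exists_isotropic_extension`). The group `T` of all Pauli operators over it is abelian, and
the character of its phases extends to `T` (`exists_fixesPhases`). An error `(e, 0)` on the sender's
side commutes with `T` if and only if `e` commutes with `S`, and it lies in `τ(T)` if and only
if `e ∈ τ(SI)`, which gives the distance. As `φ` is onto, no nontrivial error on the receiver's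
side commutes with `T`. So the reduced operators on that side are multiples of the identity, and
the code arises from an isometry of the sender (`exists_eaEncode`).

*The combination.* If `V` is an isometry into a code that detects `E'`, then `Vᴴ E' V` is a scalar.
So `E ⊗ E'` acts between states of the combined code as a multiple of `E ⊗ 1` on the
entanglement-assisted code (`detects_map_encodeRight`).
-/

set_option linter.unusedSectionVars false

noncomputable section

namespace QCode

/-! ### Roots of unity and characters -/

section Characters

variable {p : ℕ} [Fact p.Prime]

theorem isPrimitiveRoot_omega : IsPrimitiveRoot (omega p) p :=
  Complex.isPrimitiveRoot_exp p (Fact.out : p.Prime).ne_zero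

theorem omegaPow_zero : omegaPow p 0 = 1 := by simp [omegaPow]

theorem omega_ne_zero : omega p ≠ 0 := Complex.exp_ne_zero _

theorem omegaPow_ne_zero (t : ZMod p) : omegaPow p t ≠ 0 := pow_ne_zero _ omega_ne_zero

theorem omegaPow_eq_one_iff {t : ZMod p} : omegaPow p t = 1 ↔ t = 0 := by
  refine ⟨fun h => ?_, fun h => by rw [h, omegaPow_zero]⟩
  have := isPrimitiveRoot_omega.dvd_of_pow_eq_one t.val h
  exact (ZMod.val_eq_zero t).mp (Nat.eq_zero_of_dvd_of_lt this (ZMod.val_lt t))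

theorem omega_pow_eq_omegaPow (k : ℕ) : omega p ^ k = omegaPow p (k : ZMod p) := by
  rw [omegaPow, ZMod.val_natCast, ← pow_eq_pow_mod k (omega_pow_self (p := p))]

theorem star_omegaPow_mul_self (t : ZMod p) : star (omegaPow p t) * omegaPow p t = 1 := by
  have h : ‖omegaPow p t‖ = 1 := by
    rw [omegaPow, norm_pow, isPrimitiveRoot_omega.norm'_eq_one (Fact.out : p.Prime).ne_zero,
      one_pow]
  simpa [h] using Complex.conj_mul' (omegaPow p t)

variable {F ι : Type} [Field F] [Fintype F] [DecidableEq F] [Algebra (ZMod p) F] [Fintype ι]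
  [DecidableEq ι]

variable (p) in
/-- The trace pairing of `F ^ ι` with itself is nondegenerate. -/
theorem exists_trace_dotProduct_ne_zero {a : ι → F} (ha : a ≠ 0) :
    ∃ b : ι → F, Algebra.trace (ZMod p) F (b ⬝ᵥ a) ≠ 0 := by
  obtain ⟨i, hi⟩ := Function.ne_iff.mp ha
  have : CharP F p := charP_of_injective_algebraMap (algebraMap (ZMod p) F).injective p
  obtain rfl : ringChar F = p := ringChar.eq F p
  obtain ⟨t, ht⟩ := FiniteField.trace_to_zmod_nondegenerate F hi
  refine ⟨Pi.single i t, ?_⟩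
  rw [single_dotProduct, mul_comm]
  convert ht

/-- Orthogonality of the characters of `F ^ ι`. -/
theorem sum_omegaPow_trace (a : ι → F) :
    ∑ b : ι → F, omegaPow p (Algebra.trace (ZMod p) F (b ⬝ᵥ a)) =
      if a = 0 then (Fintype.card (ι → F) : ℂ) else 0 := by
  split_ifs with ha
  · simp [ha, omegaPow_zero]
  · obtain ⟨c, hc⟩ := exists_trace_dotProduct_ne_zero p ha
    -- Translation by `c` multiplies the sum by a phase other than `1`.
    have h : omegaPow p (Algebra.trace (ZMod p) F (c ⬝ᵥ a)) *
        ∑ b : ι → F, omegaPow p (Algebra.trace (ZMod p) F (b ⬝ᵥ a)) =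
        ∑ b : ι → F, omegaPow p (Algebra.trace (ZMod p) F (b ⬝ᵥ a)) := by
      rw [Finset.mul_sum, ← Equiv.sum_comp (Equiv.addLeft c)
        (fun b => omegaPow p (Algebra.trace (ZMod p) F (b ⬝ᵥ a)))]
      simp [add_dotProduct, omegaPow_add]
    by_contra h0
    exact hc (omegaPow_eq_one_iff.mp (mul_right_cancel₀ h0 (h.trans (one_mul _).symm)))

end Characters

/-! ### Products, commutation and traces of Pauli operators -/

/-- The phase space `F ^ ι × F ^ ι`, whose points `(𝐚|𝐛)` label the Pauli operators up to
phases. -/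
abbrev PhaseSpace (F ι : Type) : Type := (ι → F) × (ι → F)

section Pauli

variable {p : ℕ} [Fact p.Prime] {F ι : Type} [Field F] [Fintype F] [DecidableEq F]
  [Algebra (ZMod p) F] [Fintype ι] [DecidableEq ι]

theorem omegaPow_sum {α : Type} (s : Finset α) (f : α → ZMod p) :
    omegaPow p (∑ i ∈ s, f i) = ∏ i ∈ s, omegaPow p (f i) := by
  classical
  induction s using Finset.induction_on with
  | empty => simp [omegaPow_zero]
  | insert a s ha ih => rw [Finset.sum_insert ha, Finset.prod_insert ha, omegaPow_add, ih]

theorem opX_apply (a x y : ι → F) : opX a x y = if x = y + a then 1 else 0 := by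
  simp only [opX, tensor, shift, Matrix.of_apply]
  split_ifs with h
  · simp [h]
  · obtain ⟨i, hi⟩ := Function.ne_iff.mp h
    exact Finset.prod_eq_zero (Finset.mem_univ i) (if_neg hi)

theorem opZ_eq_diagonal (b : ι → F) :
    opZ p b = Matrix.diagonal fun y => omegaPow p (Algebra.trace (ZMod p) F (b ⬝ᵥ y)) := by
  ext x y
  simp only [opZ, tensor, clock, Matrix.of_apply, Matrix.diagonal_apply]
  split_ifs with h
  · subst h
    simp [dotProduct, map_sum, omegaPow_sum]
  · obtain ⟨i, hi⟩ := Function.ne_iff.mp h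
    exact Finset.prod_eq_zero (Finset.mem_univ i) (if_neg hi)

theorem pauli_apply (a b x y : ι → F) :
    pauli p a b x y =
      if x = y + a then omegaPow p (Algebra.trace (ZMod p) F (b ⬝ᵥ y)) else 0 := by
  rw [pauli, opZ_eq_diagonal, Matrix.mul_diagonal, opX_apply]
  split_ifs <;> simp

theorem opZ_mul_opX_eq (a b : ι → F) :
    opZ p b * opX a = omegaPow p (Algebra.trace (ZMod p) F (b ⬝ᵥ a)) • (opX a * opZ p b) := by
  ext x y
  rw [opZ_eq_diagonal, Matrix.diagonal_mul, Matrix.smul_apply, Matrix.mul_diagonal, opX_apply]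
  split_ifs with h
  · subst h
    simp [dotProduct_add, omegaPow_add, mul_comm]
  · simp

theorem pauli_mul_pauli (v w : PhaseSpace F ι) :
    pauli p v.1 v.2 * pauli p w.1 w.2 =
      omegaPow p (Algebra.trace (ZMod p) F (v.2 ⬝ᵥ w.1)) •
        pauli p (v + w).1 (v + w).2 := by
  calc pauli p v.1 v.2 * pauli p w.1 w.2 = opX v.1 * (opZ p v.2 * opX w.1) * opZ p w.2 := by
        simp only [pauli, Matrix.mul_assoc]
    _ = omegaPow p (Algebra.trace (ZMod p) F (v.2 ⬝ᵥ w.1)) •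
          ((opX v.1 * opX w.1) * (opZ p v.2 * opZ p w.2)) := by
        rw [opZ_mul_opX_eq]; simp only [Matrix.mul_smul, Matrix.smul_mul, Matrix.mul_assoc]
    _ = _ := by rw [opX_mul, opZ_mul, pauli, Prod.fst_add, Prod.snd_add]

variable (p F ι) in
/-- The form `tr ⟨v, w⟩` on phase space, bilinear over the prime field. -/
def traceForm : LinearMap.BilinForm (ZMod p) (PhaseSpace F ι) :=
  LinearMap.mk₂ (ZMod p) (fun v w => Algebra.trace (ZMod p) F (symp v w))
    (fun u v w => by
      simp only [symp, Prod.fst_add, Prod.snd_add, add_dotProduct, ← map_add]; ring_nf)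
    (fun r u v => by simp [symp, smul_dotProduct, ← smul_sub])
    (fun u v w => by
      simp only [symp, Prod.fst_add, Prod.snd_add, dotProduct_add, ← map_add]; ring_nf)
    (fun r u v => by simp [symp, dotProduct_smul, ← smul_sub])

theorem traceForm_apply (v w : PhaseSpace F ι) :
    traceForm p F ι v w = Algebra.trace (ZMod p) F (symp v w) := rfl

theorem traceForm_isAlt : (traceForm p F ι).IsAlt := fun v => by
  simp [traceForm_apply, symp, dotProduct_comm]

theorem traceForm_nondegenerate {v : PhaseSpace F ι} (h : ∀ w, traceForm p F ι v w = 0) :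
    v = 0 := by
  by_contra hv
  rcases not_and_or.mp (fun hh : v.1 = 0 ∧ v.2 = 0 => hv (Prod.ext hh.1 hh.2)) with h1 | h2
  · obtain ⟨b, hb⟩ := exists_trace_dotProduct_ne_zero p h1
    exact hb (by simpa [traceForm_apply, symp, dotProduct_comm] using h (0, b))
  · obtain ⟨a, ha⟩ := exists_trace_dotProduct_ne_zero p h2
    exact ha (by simpa [traceForm_apply, symp, dotProduct_comm] using h (a, 0))

theorem pauli_mul_comm (v w : PhaseSpace F ι) :
    pauli p v.1 v.2 * pauli p w.1 w.2 =
      omegaPow p (traceForm p F ι w v) • (pauli p w.1 w.2 * pauli p v.1 v.2) := by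
  rw [pauli_mul_pauli, pauli_mul_pauli, smul_smul, ← omegaPow_add, add_comm w v, traceForm_apply,
    ← map_add, symp, sub_add_cancel, dotProduct_comm v.2]

theorem pauli_mul_neg (v : PhaseSpace F ι) :
    ∃ c : ℂ, c ≠ 0 ∧ pauli p v.1 v.2 * pauli p (-v).1 (-v).2 = c • (1 : Op F ι) :=
  ⟨omegaPow p (Algebra.trace (ZMod p) F (v.2 ⬝ᵥ (-v).1)), omegaPow_ne_zero _, by
    rw [pauli_mul_pauli, add_neg_cancel, Prod.fst_zero, Prod.snd_zero, pauli_zero]⟩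

theorem conjTranspose_pauli_mul_self (v : PhaseSpace F ι) :
    (pauli p v.1 v.2)ᴴ * pauli p v.1 v.2 = 1 := by
  ext x y
  simp only [Matrix.mul_apply, Matrix.conjTranspose_apply, pauli_apply, Matrix.one_apply]
  rw [Finset.sum_eq_single (y + v.1)]
  · by_cases h : x = y
    · subst h; simpa using star_omegaPow_mul_self (p := p) _
    · simp [h, Ne.symm h]
  · intro z _ hz; simp [hz]
  · simp

theorem trace_pauli (v : PhaseSpace F ι) :
    (pauli p v.1 v.2).trace = if v = 0 then (Fintype.card (ι → F) : ℂ) else 0 := by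
  simp only [Matrix.trace, Matrix.diag, pauli_apply]
  by_cases h1 : v.1 = 0
  · have h0 : v = 0 ↔ v.2 = 0 := ⟨fun h => by simp [h], fun h => Prod.ext h1 h⟩
    simp only [h1, add_zero, if_true, h0, ← sum_omegaPow_trace (p := p) v.2, dotProduct_comm]
  · have h0 : v ≠ 0 := fun h => h1 (by simp [h])
    simp [h1, h0]

/-- The label of a Pauli operator is determined up to phases. -/
theorem eq_of_smul_pauli_eq {v w : PhaseSpace F ι} {c d : ℂ} (hd : d ≠ 0)
    (h : c • pauli p v.1 v.2 = d • pauli p w.1 w.2) : v = w := by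
  obtain ⟨r, hr, e⟩ := pauli_mul_neg (p := p) w
  have h' := congrArg (fun M => (M * pauli p (-w).1 (-w).2).trace) h
  simp only [Matrix.smul_mul, e, pauli_mul_pauli, Matrix.trace_smul, trace_pauli,
    Matrix.trace_one] at h'
  by_contra hvw
  rw [← sub_eq_add_neg, if_neg (sub_ne_zero.mpr hvw)] at h'
  simp [hd, hr] at h'

end Pauli

/-! ### Embeddings of symplectic spaces -/

section Symplectic

variable {K V : Type} [Field K] [AddCommGroup V] [Module K V]

/-- The orthogonal complement of the pair `e, f`. -/
def pairComplement (C : LinearMap.BilinForm K V) (e f : V) : Submodule K V :=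
  LinearMap.ker ((C e).prod (C f))

theorem mem_pairComplement {C : LinearMap.BilinForm K V} {e f v : V} :
    v ∈ pairComplement C e f ↔ C e v = 0 ∧ C f v = 0 := by
  simp [pairComplement]

theorem exists_hyperbolic_pair {C : LinearMap.BilinForm K V}
    (nC : ∀ v, (∀ w, C v w = 0) → v = 0) (hV : 0 < Module.finrank K V) :
    ∃ e f : V, C e f = 1 := by
  have := Module.nontrivial_of_finrank_pos hV
  obtain ⟨e, he⟩ := exists_ne (0 : V)
  obtain ⟨f, hf⟩ : ∃ f, C e f ≠ 0 := by
    by_contra! h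
    exact he (nC e h)
  exact ⟨e, (C e f)⁻¹ • f, by simp [hf]⟩

variable {C : LinearMap.BilinForm K V} {e f : V}

theorem pairComplement_proj_mem (hC : C.IsAlt) (hef : C e f = 1) (v : V) :
    v + C f v • e - C e v • f ∈ pairComplement C e f := by
  have hfe : C f e = -1 := by rw [← hC.neg_eq, hef]
  simp [mem_pairComplement, hef, hfe, hC e, hC f]

theorem finrank_pairComplement [FiniteDimensional K V] (hC : C.IsAlt) (hef : C e f = 1) :
    Module.finrank K (pairComplement C e f) + 2 = Module.finrank K V := by
  have hfe : C f e = -1 := by rw [← hC.neg_eq, hef]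
  have hs : LinearMap.range ((C e).prod (C f)) = ⊤ := LinearMap.range_eq_top.mpr fun x =>
    ⟨x.1 • f - x.2 • e, by ext <;> simp [hef, hfe, hC e, hC f]⟩
  rw [← LinearMap.finrank_range_add_finrank_ker ((C e).prod (C f)), hs, finrank_top,
    Module.finrank_prod, Module.finrank_self, pairComplement]
  ring

theorem pairComplement_nondegenerate (hC : C.IsAlt) (nC : ∀ v, (∀ w, C v w = 0) → v = 0)
    (hef : C e f = 1) (v : pairComplement C e f) (h : ∀ w : pairComplement C e f, C v w = 0) :
    v = 0 := by
  obtain ⟨h1, h2⟩ := mem_pairComplement.mp v.2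
  refine Subtype.ext (nC v fun w => ?_)
  have h3 := h ⟨_, pairComplement_proj_mem hC hef w⟩
  have h4 : C v e = 0 := by rw [← hC.neg_eq, h1, neg_zero]
  have h5 : C v f = 0 := by rw [← hC.neg_eq, h2, neg_zero]
  simpa [h4, h5] using h3

end Symplectic

/-- A finite-dimensional space with a nondegenerate alternating form embeds isometrically into
any other one of at least the same dimension. By induction on the dimension: a hyperbolic pair is
sent to a hyperbolic pair, and its orthogonal complement into the orthogonal complement. -/
theorem exists_symplectic_embedding {K : Type} [Field K] (d : ℕ) :
    ∀ (V W : Type) [AddCommGroup V] [Module K V] [FiniteDimensional K V]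
      [AddCommGroup W] [Module K W] [FiniteDimensional K W]
      (A : LinearMap.BilinForm K V) (B : LinearMap.BilinForm K W), A.IsAlt → B.IsAlt →
      (∀ v, (∀ w, A v w = 0) → v = 0) → (∀ v, (∀ w, B v w = 0) → v = 0) →
      Module.finrank K V = d → d ≤ Module.finrank K W →
      ∃ φ : V →ₗ[K] W, ∀ v w, B (φ v) (φ w) = A v w := by
  induction d using Nat.strong_induction_on with
  | _ d ih =>
  intro V W _ _ _ _ _ _ A B hA hB nA nB hV hW
  rcases Nat.eq_zero_or_pos d with rfl | hd
  · have := Module.finrank_zero_iff.mp hV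
    exact ⟨0, fun v w => by simp [Subsingleton.elim v 0]⟩
  obtain ⟨e, f, hef⟩ := exists_hyperbolic_pair nA (by omega)
  obtain ⟨e', f', hef'⟩ := exists_hyperbolic_pair nB (by omega)
  have hA2 := finrank_pairComplement hA hef
  have hB2 := finrank_pairComplement hB hef'
  obtain ⟨ψ, hψ⟩ := ih (d - 2) (by omega) (pairComplement A e f) (pairComplement B e' f')
    (A.restrict _) (B.restrict _) (fun v => hA v) (fun v => hB v)
    (pairComplement_nondegenerate hA nA hef) (pairComplement_nondegenerate hB nB hef')
    (by omega) (by omega)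
  let π : V →ₗ[K] pairComplement A e f :=
    LinearMap.codRestrict _ (LinearMap.id + (A f).smulRight e - (A e).smulRight f)
      (pairComplement_proj_mem hA hef)
  have hπ : ∀ v, (π v : V) = v + A f v • e - A e v • f := fun v => rfl
  refine ⟨(Submodule.subtype _).comp (ψ.comp π) - (A f).smulRight e' + (A e).smulRight f', ?_⟩
  intro v w
  have h1 : B (ψ (π v)) (ψ (π w)) = A (π v) (π w) := hψ _ _
  have m := fun v => mem_pairComplement.mp (ψ (π v)).2
  have m1 := fun v => (m v).1
  have m2 := fun v => (m v).2
  have m3 : ∀ v, B (ψ (π v)) e' = 0 := fun v => by rw [← hB.neg_eq, m1, neg_zero]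
  have m4 : ∀ v, B (ψ (π v)) f' = 0 := fun v => by rw [← hB.neg_eq, m2, neg_zero]
  have hfe : A f e = -1 := by rw [← hA.neg_eq, hef]
  have hfe' : B f' e' = -1 := by rw [← hB.neg_eq, hef']
  have hve : A v e = - A e v := (hA.neg_eq e v).symm
  have hvf : A v f = - A f v := (hA.neg_eq f v).symm
  simp only [LinearMap.add_apply, LinearMap.sub_apply, LinearMap.smulRight_apply,
    LinearMap.comp_apply, Submodule.subtype_apply, map_add, map_sub, map_smul,
    LinearMap.smul_apply, smul_eq_mul, m1, m2, m3, m4, h1, hπ, hB e', hB f', hef', hfe', hA e, hA f,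
    hef, hfe, hve, hvf]
  ring

/-! ### Groups of Pauli operators and their images in phase space -/

section PauliGroups

variable {p : ℕ} [Fact p.Prime] {F ι : Type} [Field F] [Fintype F] [DecidableEq F]
  [Algebra (ZMod p) F] [Fintype ι] [DecidableEq ι]

/-- A product of Pauli operators lies over the sum of their labels. -/
theorem exists_mul_eq {M N : Op F ι} {k l : ℕ} {v w : PhaseSpace F ι}
    (hM : M = omega p ^ k • pauli p v.1 v.2) (hN : N = omega p ^ l • pauli p w.1 w.2) :
    ∃ j : ℕ, M * N = omega p ^ j • pauli p (v + w).1 (v + w).2 := by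
  obtain ⟨t, ht⟩ := pauli_mul (p := p) v.1 v.2 w.1 w.2
  refine ⟨k + l + t, ?_⟩
  rw [hM, hN, Matrix.smul_mul, Matrix.mul_smul, ht, smul_smul, smul_smul, ← pow_add, ← pow_add]
  rfl

variable (p) in
/-- The image of a group of Pauli operators in phase space, as a subspace over the prime field. -/
def tauSubmodule (A : Subgroup (Op F ι)ˣ) : Submodule (ZMod p) (PhaseSpace F ι) where
  carrier := tau p A
  zero_mem' := ⟨1, A.one_mem, 0, by simp [pauli_zero]⟩
  add_mem' := by
    rintro v w ⟨g, hg, k, hk⟩ ⟨h, hh, l, hl⟩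
    obtain ⟨j, hj⟩ := exists_mul_eq hk hl
    exact ⟨g * h, A.mul_mem hg hh, j, by rw [Units.val_mul, hj]⟩
  smul_mem' := by
    rintro r v ⟨g, hg, k, hk⟩
    have key : ∀ m : ℕ, ∃ j : ℕ, ((g ^ m : (Op F ι)ˣ) : Op F ι) =
        omega p ^ j • pauli p (m • v).1 (m • v).2 := by
      intro m
      induction m with
      | zero => exact ⟨0, by simp [pauli_zero]⟩
      | succ m ih =>
        obtain ⟨j, hj⟩ := ih
        rw [pow_succ, Units.val_mul, succ_nsmul]
        exact exists_mul_eq hj hk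
    obtain ⟨j, hj⟩ := key r.val
    refine ⟨g ^ r.val, A.pow_mem hg _, j, ?_⟩
    rw [hj, ← Nat.cast_smul_eq_nsmul (ZMod p), ZMod.natCast_zmod_val]

/-- The Pauli operators, with all phases, whose labels lie in the subspace `L`. -/
def pauliOver (L : Submodule (ZMod p) (PhaseSpace F ι)) : Subgroup (Op F ι)ˣ where
  carrier := {g | ∃ (k : ℕ) (v : PhaseSpace F ι), v ∈ L ∧
    (g : Op F ι) = omega p ^ k • pauli p v.1 v.2}
  one_mem' := ⟨0, 0, L.zero_mem, by simp [pauli_zero]⟩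
  mul_mem' := by
    rintro g h ⟨k, v, hv, hk⟩ ⟨l, w, hw, hl⟩
    obtain ⟨j, hj⟩ := exists_mul_eq hk hl
    exact ⟨j, v + w, L.add_mem hv hw, by rw [Units.val_mul, hj]⟩
  inv_mem' := by
    rintro g ⟨k, v, hv, hk⟩
    obtain ⟨j, a, b, hj⟩ := (pauliGroup p F ι).inv_mem ⟨k, v.1, v.2, hk⟩
    refine ⟨j, (a, b), ?_, hj⟩
    obtain ⟨t, ht⟩ := exists_mul_eq (v := v) (w := (a, b)) hk hj
    have h0 : v + (a, b) = 0 := by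
      refine eq_of_smul_pauli_eq (p := p) (c := omega p ^ t) (d := 1) one_ne_zero ?_
      rw [← ht, ← Units.val_mul, mul_inv_cancel]
      simp [pauli_zero]
    rw [← neg_eq_of_add_eq_zero_right h0]
    exact L.neg_mem hv

theorem exists_unit_pauli (k : ℕ) (v : PhaseSpace F ι) :
    ∃ g : (Op F ι)ˣ, (g : Op F ι) = omega p ^ k • pauli p v.1 v.2 := by
  have h := conjTranspose_pauli_mul_self (p := p) v
  let u : (Op F ι)ˣ := ⟨pauli p v.1 v.2, _, mul_eq_one_comm.mp h, h⟩
  exact ⟨Units.mk0 (omega p ^ k) (pow_ne_zero _ omega_ne_zero) • u, rfl⟩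

theorem pauliOver_le (L : Submodule (ZMod p) (PhaseSpace F ι)) :
    pauliOver L ≤ pauliGroup p F ι := by
  rintro g ⟨k, v, -, h⟩
  exact ⟨k, v.1, v.2, h⟩

theorem tau_pauliOver (L : Submodule (ZMod p) (PhaseSpace F ι)) :
    tau p (pauliOver L) = (L : Set (PhaseSpace F ι)) := by
  ext v
  constructor
  · rintro ⟨g, ⟨k, w, hw, hk⟩, l, hl⟩
    have : v = w := eq_of_smul_pauli_eq (p := p) (pow_ne_zero k omega_ne_zero)
      (hl.symm.trans hk)
    exact this ▸ hw
  · intro hv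
    obtain ⟨g, hg⟩ := exists_unit_pauli (p := p) 0 v
    exact ⟨g, ⟨0, v, hv, hg⟩, 0, hg⟩

theorem le_pauliOver {A : Subgroup (Op F ι)ˣ} (hA : A ≤ pauliGroup p F ι) :
    A ≤ pauliOver (tauSubmodule p A) := by
  intro g hg
  obtain ⟨k, a, b, h⟩ := hA hg
  exact ⟨k, (a, b), ⟨g, hg, k, h⟩, h⟩

theorem pauliOver_mono {L L' : Submodule (ZMod p) (PhaseSpace F ι)} (h : L ≤ L') :
    pauliOver L ≤ pauliOver L' := by
  rintro g ⟨k, v, hv, hk⟩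
  exact ⟨k, v, h hv, hk⟩

theorem tauSubmodule_mono {A B : Subgroup (Op F ι)ˣ} (h : A ≤ B) :
    tauSubmodule p A ≤ tauSubmodule p B := by
  rintro v ⟨g, hg, hk⟩
  exact ⟨g, h hg, hk⟩

theorem tauSubmodule_sup {A B : Subgroup (Op F ι)ˣ} (h : A ⊔ B ≤ pauliGroup p F ι) :
    tauSubmodule p (A ⊔ B) = tauSubmodule p A ⊔ tauSubmodule p B := by
  refine le_antisymm ?_ (sup_le (tauSubmodule_mono le_sup_left) (tauSubmodule_mono le_sup_right))
  have h1 : A ⊔ B ≤ pauliOver (tauSubmodule p A ⊔ tauSubmodule p B) :=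
    sup_le ((le_pauliOver (le_sup_left.trans h)).trans (pauliOver_mono le_sup_left))
      ((le_pauliOver (le_sup_right.trans h)).trans (pauliOver_mono le_sup_right))
  intro v hv
  have h2 : v ∈ tau p (pauliOver (tauSubmodule p A ⊔ tauSubmodule p B)) :=
    tauSubmodule_mono h1 hv
  rwa [tau_pauliOver] at h2

theorem omegaPow_smul_eq_self_iff {M : Op F ι} (hM : M ≠ 0) {t : ZMod p} :
    M = omegaPow p t • M ↔ t = 0 := by
  constructor
  · intro h
    have : (1 - omegaPow p t) • M = 0 := by rw [sub_smul, one_smul, ← h, sub_self]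
    rcases smul_eq_zero.mp this with h1 | h1
    · exact omegaPow_eq_one_iff.mp (sub_eq_zero.mp h1).symm
    · exact absurd h1 hM
  · rintro rfl
    rw [omegaPow_zero, one_smul]

theorem pauli_ne_zero (v : PhaseSpace F ι) : pauli p v.1 v.2 ≠ 0 := fun h => by
  have := conjTranspose_pauli_mul_self (p := p) v
  rw [h, Matrix.mul_zero] at this
  exact zero_ne_one this

/-- The trace form decides whether Pauli operators commute. -/
theorem pauli_commute_iff {v w : PhaseSpace F ι} {k : ℕ} {M : Op F ι}
    (hM : M = omega p ^ k • pauli p w.1 w.2) :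
    pauli p v.1 v.2 * M = M * pauli p v.1 v.2 ↔ traceForm p F ι v w = 0 := by
  have h0 : pauli p v.1 v.2 * pauli p w.1 w.2 ≠ 0 := by
    rw [pauli_mul_pauli]
    exact smul_ne_zero (omegaPow_ne_zero _) (pauli_ne_zero _)
  rw [hM, Matrix.mul_smul, Matrix.smul_mul,
    (smul_right_injective _ (pow_ne_zero k omega_ne_zero)).eq_iff, pauli_mul_comm w v,
    omegaPow_smul_eq_self_iff h0]

theorem commute_all_iff {A : Subgroup (Op F ι)ˣ} (hA : A ≤ pauliGroup p F ι)
    {v : PhaseSpace F ι} :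
    (∀ g ∈ A, pauli p v.1 v.2 * (g : Op F ι) = (g : Op F ι) * pauli p v.1 v.2) ↔
      ∀ w ∈ tau p A, traceForm p F ι v w = 0 := by
  constructor
  · rintro h w ⟨g, hg, k, hk⟩
    exact (pauli_commute_iff hk).mp (h g hg)
  · intro h g hg
    obtain ⟨k, a, b, hk⟩ := hA hg
    exact (pauli_commute_iff (w := (a, b)) hk).mpr (h _ ⟨g, hg, k, hk⟩)

/-- Commuting Pauli groups have orthogonal images in phase space. -/
theorem traceForm_eq_zero_of_commute {A B : Subgroup (Op F ι)ˣ}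
    (h : ∀ g ∈ A, ∀ h ∈ B, g * h = h * g) {v w : PhaseSpace F ι} (hv : v ∈ tau p A)
    (hw : w ∈ tau p B) : traceForm p F ι v w = 0 := by
  obtain ⟨g, hg, k, hk⟩ := hv
  obtain ⟨g', hg', l, hl⟩ := hw
  refine (pauli_commute_iff (p := p) hl).mp ?_
  have := congrArg (Units.val) (h g hg g' hg')
  rw [Units.val_mul, Units.val_mul, hk, Matrix.smul_mul, Matrix.mul_smul] at this
  exact smul_right_injective _ (pow_ne_zero k omega_ne_zero) this

theorem pauliOver_commute {L : Submodule (ZMod p) (PhaseSpace F ι)}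
    (hL : ∀ v ∈ L, ∀ w ∈ L, traceForm p F ι v w = 0) :
    ∀ g ∈ pauliOver L, ∀ h ∈ pauliOver L, g * h = h * g := by
  rintro g ⟨k, v, hv, hk⟩ h ⟨l, w, hw, hl⟩
  refine Units.ext ?_
  rw [Units.val_mul, Units.val_mul, hk, Matrix.smul_mul, Matrix.mul_smul,
    (pauli_commute_iff hl).mpr (hL v hv w hw)]

theorem finite_pauliGroup : Finite (pauliGroup p F ι) := by
  have h : ∀ g : pauliGroup p F ι, ∃ x : ZMod p × PhaseSpace F ι,
      ((g : (Op F ι)ˣ) : Op F ι) = omegaPow p x.1 • pauli p x.2.1 x.2.2 := by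
    rintro ⟨g, k, a, b, hk⟩
    exact ⟨(k, (a, b)), by rw [hk, omega_pow_eq_omegaPow]⟩
  choose f hf using h
  refine Finite.of_injective f fun g g' hgg => Subtype.ext (Units.ext ?_)
  rw [hf, hf, hgg]

theorem finite_of_le_pauliGroup {A : Subgroup (Op F ι)ˣ} (hA : A ≤ pauliGroup p F ι) :
    Finite A :=
  have := finite_pauliGroup (p := p) (F := F) (ι := ι)
  Finite.of_injective _ (Subgroup.inclusion_injective hA)

/-- Pauli operators with the same label differ by a phase. -/
theorem mul_inv_eq_smul_one {g h : (Op F ι)ˣ} {k l : ℕ} {v : PhaseSpace F ι}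
    (hg : (g : Op F ι) = omega p ^ k • pauli p v.1 v.2)
    (hh : (h : Op F ι) = omega p ^ l • pauli p v.1 v.2) :
    ∃ m : ℕ, ((g * h⁻¹ : (Op F ι)ˣ) : Op F ι) = omega p ^ m • 1 ∧
      omega p ^ k = omega p ^ m * omega p ^ l := by
  have e : omega p ^ k = omega p ^ (k + (p - 1) * l) * omega p ^ l := by
    have hp : (p - 1) * l + l = p * l := by
      rw [← Nat.succ_mul, Nat.succ_eq_add_one, Nat.sub_add_cancel (Fact.out : p.Prime).one_le]
    rw [← pow_add, add_assoc, hp, pow_add, pow_mul, omega_pow_self, one_pow, mul_one]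
  refine ⟨_, ?_, e⟩
  rw [Units.val_mul, hg, e, mul_smul, ← hh, Matrix.smul_mul, ← Units.val_mul, mul_inv_cancel,
    Units.val_one]

/-- A group that omits `ω I` contains no other nontrivial phase. -/
theorem phase_eq_one {A : Subgroup (Op F ι)ˣ} (h : ∀ g ∈ A, (g : Op F ι) ≠ omega p • 1)
    {g : (Op F ι)ˣ} (hg : g ∈ A) {k : ℕ} (hk : (g : Op F ι) = omega p ^ k • 1) :
    omega p ^ k = 1 := by
  by_contra hne
  have ht : (k : ZMod p) ≠ 0 := fun h0 => hne (by
    rw [omega_pow_eq_omegaPow, h0, omegaPow_zero])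
  refine h (g ^ ((k : ZMod p)⁻¹).val) (A.pow_mem hg _) ?_
  rw [Units.val_pow_eq_pow_val, hk, smul_pow, one_pow, ← pow_mul, omega_pow_eq_omegaPow]
  push_cast
  rw [ZMod.natCast_zmod_val, mul_inv_cancel₀ ht]
  simpa using congrArg (· • (1 : Op F ι)) (omega_pow_eq_omegaPow (p := p) 1).symm

/-- A Pauli group that omits `ω I` has as many elements as its image in phase space. -/
theorem card_tauSubmodule_of_forall_ne {A : Subgroup (Op F ι)ˣ} (hA : A ≤ pauliGroup p F ι)
    (h : ∀ g ∈ A, (g : Op F ι) ≠ omega p • 1) : Nat.card (tauSubmodule p A) = Nat.card A := by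
  have hl : ∀ v : tauSubmodule p A, ∃ g : A, ∃ k : ℕ,
      ((g : (Op F ι)ˣ) : Op F ι) = omega p ^ k • pauli p v.1.1 v.1.2 := by
    rintro ⟨v, g, hg, k, hk⟩
    exact ⟨⟨g, hg⟩, k, hk⟩
  choose f k hf using hl
  refine Nat.card_eq_of_bijective f ⟨fun v w hvw => Subtype.ext ?_, fun g => ?_⟩
  · exact eq_of_smul_pauli_eq (p := p) (pow_ne_zero (k w) omega_ne_zero)
      ((hf v).symm.trans ((congrArg (fun x : A => ((x : (Op F ι)ˣ) : Op F ι)) hvw).trans (hf w)))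
  · obtain ⟨j, a, b, hj⟩ := hA g.2
    let v : tauSubmodule p A := ⟨(a, b), g, g.2, j, hj⟩
    obtain ⟨m, hm, -⟩ := mul_inv_eq_smul_one (hf v) (v := (a, b)) hj
    have h1 := phase_eq_one h (A.mul_mem (f v).2 (A.inv_mem g.2)) hm
    rw [h1, one_smul] at hm
    exact ⟨v, Subtype.ext (mul_inv_eq_one.mp (Units.ext hm))⟩

end PauliGroups

/-! ### Joint eigenspaces of Pauli groups -/

section Eigenspaces

variable {p : ℕ} [Fact p.Prime] {F ι : Type} [Field F] [Fintype F] [DecidableEq F]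
  [Algebra (ZMod p) F] [Fintype ι] [DecidableEq ι]

variable (p) in
/-- The character `χ` takes each phase in `T` to itself, which is necessary for `χ` to have a
nonzero eigenspace. -/
def FixesPhases (T : Subgroup (Op F ι)ˣ) (χ : T →* ℂˣ) : Prop :=
  ∀ (g : T) (k : ℕ), ((g : (Op F ι)ˣ) : Op F ι) = omega p ^ k • 1 → (χ g : ℂ) = omega p ^ k

/-- `Q` is the joint eigenspace of `T` for the character `χ`. -/
def IsEigenCode (T : Subgroup (Op F ι)ˣ) (χ : T →* ℂˣ) (Q : Submodule ℂ (State F ι)) : Prop :=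
  ∀ v : State F ι, v ∈ Q ↔ ∀ g : T, ((g : (Op F ι)ˣ) : Op F ι) *ᵥ v = (χ g : ℂ) • v

theorem exists_isEigenCode (T : Subgroup (Op F ι)ˣ) (χ : T →* ℂˣ) :
    ∃ Q : Submodule ℂ (State F ι), IsEigenCode T χ Q :=
  ⟨⨅ g : T, LinearMap.ker (Matrix.mulVecLin ((g : (Op F ι)ˣ) : Op F ι) - (χ g : ℂ) • LinearMap.id),
    fun v => by simp [sub_eq_zero]⟩

/-- The scalar matrices in an abelian Pauli group act through a character, which extends to the
whole group because `ℂˣ` is divisible. -/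
theorem exists_fixesPhases {T : Subgroup (Op F ι)ˣ} (hT : T ≤ pauliGroup p F ι)
    (hab : ∀ g ∈ T, ∀ h ∈ T, g * h = h * g) : ∃ χ : T →* ℂˣ, FixesPhases p T χ := by
  have hfin := finite_of_le_pauliGroup hT
  let _ : CommGroup T :=
    { (inferInstance : Group T) with
      mul_comm := fun g h => Subtype.ext (hab g g.2 h h.2) }
  let Z : Subgroup T :=
    { carrier := {g | ∃ c : ℂ, ((g : (Op F ι)ˣ) : Op F ι) = c • 1}
      one_mem' := ⟨1, by simp⟩
      mul_mem' := by
        rintro g h ⟨c, hc⟩ ⟨d, hd⟩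
        exact ⟨c * d, by rw [Subgroup.coe_mul, Units.val_mul, hc, hd, Matrix.smul_mul, one_mul,
          smul_smul]⟩
      inv_mem' := by
        rintro g ⟨c, hc⟩
        have h1 : ((g : (Op F ι)ˣ) : Op F ι) * (((g⁻¹ : T) : (Op F ι)ˣ) : Op F ι) = 1 := by
          rw [← Units.val_mul, ← Subgroup.coe_mul, mul_inv_cancel]; rfl
        have hc0 : c ≠ 0 := by
          rintro rfl
          rw [hc, zero_smul, zero_mul] at h1
          exact zero_ne_one h1
        refine ⟨c⁻¹, ?_⟩
        rw [hc, Matrix.smul_mul, one_mul] at h1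
        rw [← h1, smul_smul, inv_mul_cancel₀ hc0, one_smul] }
  -- A scalar matrix is read off from its entry at `(0, 0)`.
  let φ : Z →* ℂ :=
    { toFun := fun g => (((g : T) : (Op F ι)ˣ) : Op F ι) 0 0
      map_one' := by simp
      map_mul' := by
        rintro ⟨g, c, hc⟩ ⟨h, d, hd⟩
        simp [hc, hd]
        ring }
  have : NeZero (Monoid.exponent T) := ⟨Monoid.exponent_ne_zero_of_finite⟩
  obtain ⟨χ, hχ⟩ := MonoidHom.domRestrict_surjective ℂ Z φ.toHomUnits
  refine ⟨χ, fun g k hk => ?_⟩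
  have h1 := DFunLike.congr_fun hχ ⟨g, omega p ^ k, hk⟩
  have h2 : (χ g : ℂ) = ((g : (Op F ι)ˣ) : Op F ι) 0 0 := congrArg Units.val h1
  rw [h2, hk]
  simp

/-- Dividing the elements of `T` by their eigenvalues gives operators `G v` that depend only on
the label `v`, and that fix the joint eigenspace. -/
theorem exists_normalized {T : Subgroup (Op F ι)ˣ} {χ : T →* ℂˣ} (hχ : FixesPhases p T χ) :
    ∃ G : tauSubmodule p T → Op F ι, (∀ v, ∃ c : ℂ, G v = c • pauli p v.1.1 v.1.2) ∧
      ∀ (g : T) (v : tauSubmodule p T) (k : ℕ),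
        ((g : (Op F ι)ˣ) : Op F ι) = omega p ^ k • pauli p v.1.1 v.1.2 →
        ((g : (Op F ι)ˣ) : Op F ι) = (χ g : ℂ) • G v := by
  have hl : ∀ v : tauSubmodule p T, ∃ g : T, ∃ k : ℕ,
      ((g : (Op F ι)ˣ) : Op F ι) = omega p ^ k • pauli p v.1.1 v.1.2 := by
    rintro ⟨v, g, hg, k, hk⟩
    exact ⟨⟨g, hg⟩, k, hk⟩
  choose f k hf using hl
  refine ⟨fun v => (χ (f v) : ℂ)⁻¹ • ((f v : (Op F ι)ˣ) : Op F ι), fun v =>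
    ⟨(χ (f v) : ℂ)⁻¹ * omega p ^ k v, by simp only [hf v, smul_smul]⟩, fun g v j hj => ?_⟩
  obtain ⟨m, hm, e⟩ := mul_inv_eq_smul_one hj (hf v)
  have h1 := hχ (g * (f v)⁻¹) m hm
  rw [map_mul, map_inv, Units.val_mul, Units.val_inv_eq_inv_val] at h1
  simp only
  rw [smul_smul, h1, hj, e, mul_smul, ← hf v]

variable {T : Subgroup (Op F ι)ˣ} {χ : T →* ℂˣ} {Q : Submodule ℂ (State F ι)}

/-- The projection onto a joint eigenspace, as an average of Pauli operators with labels
in `τ(T)`: its trace is the dimension, and its product with a Pauli operator outside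
`τ(T)` has trace zero. -/
theorem exists_projection (hT : T ≤ pauliGroup p F ι) (hχ : FixesPhases p T χ)
    (hQ : IsEigenCode T χ Q) :
    ∃ P : Op F ι, (∀ v, P *ᵥ v ∈ Q) ∧ (∀ v ∈ Q, P *ᵥ v = v) ∧
      P.trace * Nat.card (tauSubmodule p T) = Fintype.card (ι → F) ∧
      ∀ e ∉ tau p T, (P * pauli p e.1 e.2).trace = 0 := by
  classical
  obtain ⟨G, hG, hGT⟩ := exists_normalized hχ
  have := Fintype.ofFinite (tauSubmodule p T)
  have hcard : (Nat.card (tauSubmodule p T) : ℂ) ≠ 0 := by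
    exact_mod_cast Nat.card_pos.ne'
  have lift : ∀ v : tauSubmodule p T, ∃ g : T, ∃ k : ℕ,
      ((g : (Op F ι)ˣ) : Op F ι) = omega p ^ k • pauli p v.1.1 v.1.2 := by
    rintro ⟨v, g, hg, k, hk⟩
    exact ⟨⟨g, hg⟩, k, hk⟩
  have label : ∀ g : T, ∃ v : tauSubmodule p T, ∃ k : ℕ,
      ((g : (Op F ι)ˣ) : Op F ι) = omega p ^ k • pauli p v.1.1 v.1.2 := by
    rintro ⟨g, hg⟩
    obtain ⟨k, a, b, hk⟩ := hT hg
    exact ⟨⟨(a, b), g, hg, k, hk⟩, k, hk⟩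
  have hχ0 : ∀ g : T, (χ g : ℂ) ≠ 0 := fun g => (χ g).ne_zero
  have hmul : ∀ (g : T) (w v : tauSubmodule p T) (k : ℕ),
      ((g : (Op F ι)ˣ) : Op F ι) = omega p ^ k • pauli p w.1.1 w.1.2 →
      ((g : (Op F ι)ˣ) : Op F ι) * G v = (χ g : ℂ) • G (w + v) := by
    intro g w v k hk
    -- Write `G v = χ(h)⁻¹ h` with `h` over `v`; then `g h` lies over `w + v`.
    obtain ⟨h, l, hl⟩ := lift v
    obtain ⟨j, hj⟩ := exists_mul_eq hk hl
    have h1 := hGT (g * h) (w + v) j (by simpa using hj)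
    have h2 := hGT h v l hl
    rw [Subgroup.coe_mul, Units.val_mul, map_mul, Units.val_mul, mul_comm (χ g : ℂ), mul_smul]
      at h1
    nth_rewrite 1 [h2] at h1
    rw [Matrix.mul_smul] at h1
    exact smul_right_injective _ (hχ0 h) h1
  have h0 : G 0 = 1 := by
    have := hGT 1 0 0 (by simp [pauli_zero])
    simpa using this.symm
  have htr : ∀ v, (G v).trace = if v = 0 then (Fintype.card (ι → F) : ℂ) else 0 := by
    intro v
    split_ifs with hv
    · simp [hv, h0]
    · obtain ⟨c, hc⟩ := hG v
      rw [hc, Matrix.trace_smul, trace_pauli, if_neg (by simpa using hv), smul_zero]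
  refine ⟨(Nat.card (tauSubmodule p T) : ℂ)⁻¹ • ∑ v, G v, ?_, ?_, ?_, ?_⟩
  · intro u
    refine (hQ _).mpr fun g => ?_
    obtain ⟨w, k, hk⟩ := label g
    rw [Matrix.mulVec_mulVec, Matrix.mul_smul, Matrix.mul_sum,
      Finset.sum_congr rfl fun v _ => hmul g w v k hk, ← Finset.smul_sum,
      show ∑ v, G (w + v) = ∑ v, G v from Equiv.sum_comp (Equiv.addLeft w) G, smul_comm,
      Matrix.smul_mulVec]
  · intro u hu
    have hfix : ∀ v, G v *ᵥ u = u := by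
      intro v
      obtain ⟨g, k, hk⟩ := lift v
      have h1 := (hQ u).mp hu g
      rw [hGT g v k hk, Matrix.smul_mulVec] at h1
      exact smul_right_injective _ (hχ0 g) h1
    rw [Matrix.smul_mulVec, Matrix.sum_mulVec, Finset.sum_congr rfl fun v _ => hfix v,
      Finset.sum_const, Finset.card_univ, ← Nat.card_eq_fintype_card, ← Nat.cast_smul_eq_nsmul ℂ,
      smul_smul, inv_mul_cancel₀ hcard, one_smul]
  · rw [Matrix.trace_smul, Matrix.trace_sum]
    simp only [htr, Finset.sum_ite_eq', Finset.mem_univ, if_true, smul_eq_mul]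
    field_simp
  · intro e he
    rw [Matrix.smul_mul, Matrix.sum_mul, Matrix.trace_smul, Matrix.trace_sum,
      Finset.sum_eq_zero, smul_zero]
    intro v _
    obtain ⟨c, hc⟩ := hG v
    have hne : v.1 + e ≠ 0 := fun h => he (by
      rw [← neg_eq_of_add_eq_zero_right h]
      exact (tauSubmodule p T).neg_mem v.2)
    rw [hc, Matrix.smul_mul, pauli_mul_pauli, Matrix.trace_smul, Matrix.trace_smul, trace_pauli,
      if_neg hne, smul_zero, smul_zero]

theorem trace_eq_finrank {P : Op F ι} (h1 : ∀ v, P *ᵥ v ∈ Q) (h2 : ∀ v ∈ Q, P *ᵥ v = v) :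
    P.trace = Module.finrank ℂ Q := by
  have h : LinearMap.IsProj Q (Matrix.toLin' P) := ⟨h1, h2⟩
  rw [← h.trace, Matrix.trace_toLin'_eq]

theorem finrank_mul_card (hT : T ≤ pauliGroup p F ι) (hχ : FixesPhases p T χ)
    (hQ : IsEigenCode T χ Q) :
    Module.finrank ℂ Q * Nat.card (tauSubmodule p T) = Fintype.card F ^ Fintype.card ι := by
  obtain ⟨P, h1, h2, h3, -⟩ := exists_projection hT hχ hQ
  rw [trace_eq_finrank h1 h2] at h3
  rw [← Fintype.card_fun]
  exact_mod_cast h3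

open scoped ComplexOrder in
theorem eq_zero_of_star_dotProduct_self {α : Type} [Fintype α] {u : α → ℂ}
    (h : star u ⬝ᵥ u = 0) : u = 0 :=
  dotProduct_star_self_eq_zero.mp h

/-- Errors that do not commute with an eigenoperator map the eigenspace into its orthogonal
complement. -/
theorem dotProduct_mulVec_eq_zero {e w : PhaseSpace F ι} {k : ℕ} {g : Op F ι} {c : ℂ}
    (hg : g = omega p ^ k • pauli p w.1 w.2) (hew : traceForm p F ι e w ≠ 0)
    {u v : State F ι} (hu : g *ᵥ u = c • u) (hv : g *ᵥ v = c • v) :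
    star u ⬝ᵥ (pauli p e.1 e.2 *ᵥ v) = 0 := by
  have hgg : gᴴ * g = 1 := by
    have : star (omega p ^ k) * omega p ^ k = 1 := by
      rw [omega_pow_eq_omegaPow]; exact star_omegaPow_mul_self _
    rw [hg, Matrix.conjTranspose_smul, Matrix.smul_mul, Matrix.mul_smul, smul_smul,
      conjTranspose_pauli_mul_self, this, one_smul]
  have hinv : ∀ x y : State F ι, star (g *ᵥ x) ⬝ᵥ (g *ᵥ y) = star x ⬝ᵥ y := by
    intro x y
    rw [Matrix.star_mulVec, ← Matrix.dotProduct_mulVec, Matrix.mulVec_mulVec, hgg,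
      Matrix.one_mulVec]
  have hcc : u ≠ 0 → star c * c = 1 := by
    intro hu0
    have h1 := hinv u u
    rw [hu, star_smul, smul_dotProduct, dotProduct_smul, smul_smul, smul_eq_mul] at h1
    exact mul_right_cancel₀ (fun h => hu0 (eq_zero_of_star_dotProduct_self h))
      (h1.trans (one_mul _).symm)
  by_cases hu0 : u = 0
  · simp [hu0]
  have hcomm : g * pauli p e.1 e.2 = omegaPow p (traceForm p F ι e w) • (pauli p e.1 e.2 * g) := by
    rw [hg, Matrix.smul_mul, pauli_mul_comm, Matrix.mul_smul, smul_comm]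
  have h1 := hinv u (pauli p e.1 e.2 *ᵥ v)
  rw [Matrix.mulVec_mulVec, hcomm, Matrix.smul_mulVec, ← Matrix.mulVec_mulVec, hv, hu,
    Matrix.mulVec_smul, star_smul, smul_dotProduct, dotProduct_smul, dotProduct_smul, smul_eq_mul,
    smul_eq_mul, smul_eq_mul, mul_left_comm _ c, ← mul_assoc, hcc hu0, one_mul] at h1
  by_contra hne
  exact hew (omegaPow_eq_one_iff.mp (mul_right_cancel₀ hne (h1.trans (one_mul _).symm)))

/-- A nonzero joint eigenspace fails to detect exactly the Pauli errors that commute with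
`T` and are not in `T` up to phases. -/
theorem detects_iff (hT : T ≤ pauliGroup p F ι) (hχ : FixesPhases p T χ)
    (hQ : IsEigenCode T χ Q) (e : PhaseSpace F ι) :
    Detects Q (pauli p e.1 e.2) ↔
      ¬ ((∀ w ∈ tau p T, traceForm p F ι e w = 0) ∧ e ∉ tau p T) := by
  have hpos : Module.finrank ℂ Q ≠ 0 := fun h => by
    have := finrank_mul_card hT hχ hQ
    rw [h, zero_mul] at this
    exact (pow_ne_zero _ Fintype.card_ne_zero) this.symm
  constructor
  · rintro ⟨lam, hlam⟩ ⟨hcomm, he⟩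
    have hE : ∀ v ∈ Q, pauli p e.1 e.2 *ᵥ v ∈ Q := by
      intro v hv
      refine (hQ _).mpr fun g => ?_
      rw [Matrix.mulVec_mulVec, ← (commute_all_iff hT).mpr hcomm g g.2, ← Matrix.mulVec_mulVec,
        (hQ v).mp hv g, Matrix.mulVec_smul]
    -- The vector `E v - lam v` lies in `Q` and is orthogonal to `Q`.
    have hscal : ∀ v ∈ Q, pauli p e.1 e.2 *ᵥ v = lam • v := by
      intro v hv
      have hd : pauli p e.1 e.2 *ᵥ v - lam • v ∈ Q := Q.sub_mem (hE v hv) (Q.smul_mem _ hv)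
      have h := hlam _ hd v hv
      rw [← smul_eq_mul, ← dotProduct_smul, ← sub_eq_zero, ← dotProduct_sub] at h
      exact sub_eq_zero.mp (eq_zero_of_star_dotProduct_self h)
    obtain ⟨P, h1, h2, -, h4⟩ := exists_projection hT hχ hQ
    have hEP : pauli p e.1 e.2 * P = lam • P := by
      refine Matrix.toLin'.injective (LinearMap.ext fun v => ?_)
      simp only [Matrix.toLin'_apply, ← Matrix.mulVec_mulVec, hscal _ (h1 v), Matrix.smul_mulVec]
    have htr := h4 e he
    -- The trace of `P E = lam P` is zero, while that of `P` is positive.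
    rw [Matrix.trace_mul_comm, hEP, Matrix.trace_smul, trace_eq_finrank h1 h2, smul_eq_mul,
      mul_eq_zero, or_iff_left (by exact_mod_cast hpos)] at htr
    have hQ0 : Q = ⊥ := by
      refine (Submodule.eq_bot_iff Q).mpr fun v hv => ?_
      have h := congrArg ((pauli p e.1 e.2)ᴴ *ᵥ ·) (hscal v hv)
      simpa [htr, Matrix.mulVec_mulVec, conjTranspose_pauli_mul_self] using h
    exact hpos (by rw [hQ0, finrank_bot])
  · intro h
    by_cases hcomm : ∀ w ∈ tau p T, traceForm p F ι e w = 0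
    · have he : e ∈ tau p T := by_contra fun h' => h ⟨hcomm, h'⟩
      obtain ⟨g, hg, k, hk⟩ := he
      refine ⟨(omega p ^ k)⁻¹ * (χ ⟨g, hg⟩ : ℂ), fun u _ v hv => ?_⟩
      have h1 := (hQ v).mp hv ⟨g, hg⟩
      have h2 : pauli p e.1 e.2 *ᵥ v = ((omega p ^ k)⁻¹ * (χ ⟨g, hg⟩ : ℂ)) • v := by
        rw [mul_smul, ← h1, hk, Matrix.smul_mulVec, smul_smul,
          inv_mul_cancel₀ (pow_ne_zero k omega_ne_zero), one_smul]
      rw [h2, dotProduct_smul, smul_eq_mul]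
    · push Not at hcomm
      obtain ⟨w, ⟨g, hg, k, hk⟩, hw⟩ := hcomm
      refine ⟨0, fun u hu v hv => ?_⟩
      rw [zero_mul, dotProduct_mulVec_eq_zero hk hw ((hQ u).mp hu ⟨g, hg⟩) ((hQ v).mp hv ⟨g, hg⟩)]

end Eigenspaces

/-! ### Isometric encodings -/

section Encodings

/-- A subspace of large enough dimension contains the image of an isometry. -/
theorem exists_isometry {X Y : Type} [Fintype X] [Fintype Y] [DecidableEq Y]
    (Q : Submodule ℂ (X → ℂ)) (h : Fintype.card Y ≤ Module.finrank ℂ Q) :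
    ∃ M : Matrix X Y ℂ, Mᴴ * M = 1 ∧ ∀ y, M *ᵥ y ∈ Q := by
  let L := (WithLp.linearEquiv 2 ℂ (X → ℂ)).symm
  let E : Submodule ℂ (EuclideanSpace ℂ X) := Q.map L.toLinearMap
  have hE : Module.finrank ℂ E = Module.finrank ℂ Q := LinearEquiv.finrank_map_eq L Q
  let b := stdOrthonormalBasis ℂ E
  obtain ⟨j⟩ : Nonempty (Y ↪ Fin (Module.finrank ℂ E)) :=
    Function.Embedding.nonempty_of_card_le (by simpa [hE] using h)
  have hmem : ∀ i, (fun x => (b i : EuclideanSpace ℂ X) x) ∈ Q := by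
    intro i
    obtain ⟨q, hq, e⟩ := (b i).2
    rw [← e]
    exact hq
  refine ⟨Matrix.of fun x y => (b (j y) : EuclideanSpace ℂ X) x, ?_, fun y => ?_⟩
  · ext y y'
    have := orthonormal_iff_ite.mp b.orthonormal (j y) (j y')
    rw [Submodule.coe_inner, PiLp.inner_apply] at this
    simp only [Matrix.mul_apply, Matrix.conjTranspose_apply, Matrix.of_apply, Matrix.one_apply]
    simpa [mul_comm, j.injective.eq_iff] using this
  · have e : (Matrix.of fun x y => (b (j y) : EuclideanSpace ℂ X) x) *ᵥ y =
        ∑ i, y i • fun x => (b (j i) : EuclideanSpace ℂ X) x := by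
      funext x
      simp [Matrix.mulVec, dotProduct, mul_comm]
    rw [e]
    exact Q.sum_mem fun i _ => Q.smul_mem _ (hmem _)

/-- In the case of equal dimensions, the isometry maps onto the subspace. -/
theorem exists_isometry_onto {X Y : Type} [Fintype X] [Fintype Y] [DecidableEq Y]
    (Q : Submodule ℂ (X → ℂ)) (h : Module.finrank ℂ Q = Fintype.card Y) :
    ∃ M : Matrix X Y ℂ, Mᴴ * M = 1 ∧ LinearMap.range M.mulVecLin = Q := by
  obtain ⟨M, hM, hQ⟩ := exists_isometry Q h.ge
  refine ⟨M, hM, Submodule.eq_of_le_of_finrank_eq ?_ ?_⟩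
  · rintro _ ⟨y, rfl⟩
    exact hQ y
  · rw [LinearMap.finrank_range_of_inj, h, Module.finrank_fintype_fun_eq_card]
    intro y y' hyy
    have := congrArg (Mᴴ *ᵥ ·) hyy
    simpa [Matrix.mulVec_mulVec, hM] using this

/-- An isometry carries inner products. -/
theorem star_mulVec_dotProduct_mulVec {X Y : Type} [Fintype X] [Fintype Y] [DecidableEq Y]
    {M : Matrix X Y ℂ} (hM : Mᴴ * M = 1) (u v : Y → ℂ) :
    star (M *ᵥ u) ⬝ᵥ (M *ᵥ v) = star u ⬝ᵥ v := by
  rw [Matrix.star_mulVec, ← Matrix.dotProduct_mulVec, Matrix.mulVec_mulVec, hM, Matrix.one_mulVec]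

variable {p : ℕ} [Fact p.Prime] {F ι κ : Type} [Field F] [Fintype F] [DecidableEq F]
  [Algebra (ZMod p) F] [Fintype ι] [DecidableEq ι] [Fintype κ] [DecidableEq κ]

variable (p) in
/-- A matrix whose pairings with all nontrivial Pauli operators vanish is scalar, by Fourier
inversion along each diagonal `x = y + a`. -/
theorem eq_of_sum_mul_pauli (M : Op F κ) (r : ℂ)
    (h : ∀ e : PhaseSpace F κ, ∑ x, ∑ y, M x y * pauli p e.1 e.2 x y = if e = 0 then r else 0)
    (x y : κ → F) : M x y = if x = y then r / Fintype.card (κ → F) else 0 := by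
  have hcard : (Fintype.card (κ → F) : ℂ) ≠ 0 := by exact_mod_cast Fintype.card_ne_zero
  have hdiag : ∀ a b : κ → F, ∑ z, M (z + a) z *
      omegaPow p (Algebra.trace (ZMod p) F (b ⬝ᵥ z)) = if (a, b) = 0 then r else 0 := by
    intro a b
    rw [← h (a, b), Finset.sum_comm]
    refine Finset.sum_congr rfl fun z _ => ?_
    simp [pauli_apply]
  obtain ⟨a, rfl⟩ : ∃ a, x = y + a := ⟨x - y, by abel⟩
  have h1 : ∑ b : κ → F, (∑ z, M (z + a) z *
      omegaPow p (Algebra.trace (ZMod p) F (b ⬝ᵥ z))) *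
        omegaPow p (Algebra.trace (ZMod p) F (b ⬝ᵥ (-y))) =
      Fintype.card (κ → F) * M (y + a) y := by
    simp only [Finset.sum_mul, mul_assoc, ← omegaPow_add, ← map_add, ← dotProduct_add]
    rw [Finset.sum_comm]
    simp only [← Finset.mul_sum, sum_omegaPow_trace, ← sub_eq_add_neg, sub_eq_zero]
    simp [mul_comm]
  have h2 : (Fintype.card (κ → F) : ℂ) * M (y + a) y = if a = 0 then r else 0 := by
    rw [← h1, Finset.sum_congr rfl fun b _ => by rw [hdiag a b]]
    rw [Finset.sum_eq_single 0]
    · simp [omegaPow_zero]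
    · intro b _ hb; simp [hb]
    · simp
  have h3 : y + a = y ↔ a = 0 := by simp
  simp only [h3]
  split_ifs with ha
  · rw [if_pos ha] at h2
    rw [← h2]
    field_simp
  · rw [if_neg ha] at h2
    exact (mul_eq_zero.mp h2).resolve_left hcard

/-- Summation over the basis states of a composite register. -/
theorem sum_sumElim (f : (ι ⊕ κ → F) → ℂ) :
    ∑ z, f z = ∑ x : ι → F, ∑ y : κ → F, f (Sum.elim x y) := by
  rw [← Fintype.sum_prod_type', ← Equiv.sum_comp (Equiv.sumArrowEquivProdArrow ι κ F).symm]
  rfl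

variable {μ : Type} [Fintype μ] [DecidableEq μ]

/-- The tensor product of operators between composite registers. -/
def registerTensor {α β γ δ : Type} (A : Matrix (α → F) (β → F) ℂ) (B : Matrix (γ → F) (δ → F) ℂ) :
    Matrix (α ⊕ γ → F) (β ⊕ δ → F) ℂ :=
  (Matrix.kroneckerMap (· * ·) A B).submatrix (Equiv.sumArrowEquivProdArrow α γ F)
    (Equiv.sumArrowEquivProdArrow β δ F)

theorem registerTensor_apply {α β γ δ : Type} (A : Matrix (α → F) (β → F) ℂ)
    (B : Matrix (γ → F) (δ → F) ℂ) (z : α ⊕ γ → F) (w : β ⊕ δ → F) :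
    registerTensor A B z w =
      A (z ∘ Sum.inl) (w ∘ Sum.inl) * B (z ∘ Sum.inr) (w ∘ Sum.inr) := rfl

theorem registerTensor_mul {α β γ δ ε ζ : Type} [Fintype β] [DecidableEq β] [Fintype δ]
    [DecidableEq δ] (A : Matrix (α → F) (β → F) ℂ) (B : Matrix (γ → F) (δ → F) ℂ)
    (A' : Matrix (β → F) (ε → F) ℂ) (B' : Matrix (δ → F) (ζ → F) ℂ) :
    registerTensor A B * registerTensor A' B' = registerTensor (A * A') (B * B') := by
  rw [registerTensor, registerTensor, Matrix.submatrix_mul_equiv, ← Matrix.mul_kronecker_mul]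
  rfl

theorem conjTranspose_registerTensor {α β γ δ : Type} (A : Matrix (α → F) (β → F) ℂ)
    (B : Matrix (γ → F) (δ → F) ℂ) : (registerTensor A B)ᴴ = registerTensor Aᴴ Bᴴ := by
  ext z w
  simp [registerTensor_apply]

/-- Pauli operators of a composite register are tensor products. -/
theorem pauli_sumElim (a b : ι → F) (a' b' : κ → F) :
    pauli p (Sum.elim a a') (Sum.elim b b') = registerTensor (pauli p a b) (pauli p a' b') := by
  ext z w
  have h1 : z = w + Sum.elim a a' ↔
      z ∘ Sum.inl = w ∘ Sum.inl + a ∧ z ∘ Sum.inr = w ∘ Sum.inr + a' := by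
    simp [funext_iff]
  have h2 : (Sum.elim b b' ⬝ᵥ w : F) = b ⬝ᵥ (w ∘ Sum.inl) + b' ⬝ᵥ (w ∘ Sum.inr) := by
    simp [dotProduct]
  simp only [registerTensor_apply, pauli_apply, h1, h2, map_add, omegaPow_add]
  by_cases hx : z ∘ Sum.inl = w ∘ Sum.inl + a <;>
    by_cases hy : z ∘ Sum.inr = w ∘ Sum.inr + a' <;> simp [hx, hy]

theorem encodeRight_eq_mulVec (V : Matrix (μ → F) (κ → F) ℂ) (ψ : State F (ι ⊕ κ)) :
    encodeRight V ψ = registerTensor (1 : Op F ι) V *ᵥ ψ := by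
  funext z
  simp only [encodeRight, LinearMap.coe_mk, AddHom.coe_mk, Matrix.mulVec, dotProduct,
    sum_sumElim, registerTensor_apply, Sum.elim_comp_inl, Sum.elim_comp_inr, Matrix.one_apply]
  rw [Finset.sum_eq_single (z ∘ Sum.inl)]
  · simp
  · intro x _ hx; simp [Ne.symm hx]
  · simp

/-- If `Q` detects `E` on the first register and the image of `V` lies in a code that detects
`E'`, then the encoded code detects `E ⊗ E'`: between the encodings the second factor becomes the
scalar `Vᴴ E' V`. -/
theorem detects_map_encodeRight {Q : Submodule ℂ (State F (ι ⊕ κ))}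
    {Qb : Submodule ℂ (State F μ)} {V : Matrix (μ → F) (κ → F) ℂ} (hV : Vᴴ * V = 1)
    (hVQ : ∀ y, V *ᵥ y ∈ Qb) {a b : ι → F} {a' b' : μ → F}
    (h : Detects Q (pauli p (Sum.elim a (0 : κ → F)) (Sum.elim b (0 : κ → F))))
    (h' : Detects Qb (pauli p a' b')) :
    Detects (Q.map (encodeRight V)) (pauli p (Sum.elim a a') (Sum.elim b b')) := by
  obtain ⟨r, hr⟩ := h
  obtain ⟨s, hs⟩ := h'
  have hE : Vᴴ * (pauli p a' b' * V) = s • (1 : Op F κ) := by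
    ext x y
    have h1 := hs _ (hVQ (Pi.single x 1)) _ (hVQ (Pi.single y 1))
    rw [star_mulVec_dotProduct_mulVec hV, Matrix.mulVec_mulVec, Matrix.star_mulVec,
      ← Matrix.dotProduct_mulVec, Matrix.mulVec_mulVec] at h1
    have h2 : star (Pi.single x (1 : ℂ) : (κ → F) → ℂ) = Pi.single x 1 := by
      rw [← Pi.single_star, star_one]
    simpa [h2, Matrix.one_apply, Pi.single_apply, eq_comm] using h1
  have hR : ∀ A : Op F ι, ∀ B : Op F μ, (registerTensor (1 : Op F ι) V)ᴴ *
      (registerTensor A B * registerTensor (1 : Op F ι) V) = registerTensor A (Vᴴ * (B * V)) := by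
    intro A B
    rw [conjTranspose_registerTensor, registerTensor_mul, registerTensor_mul,
      Matrix.conjTranspose_one, one_mul, mul_one]
  have hR1 : (registerTensor (1 : Op F ι) V)ᴴ * registerTensor (1 : Op F ι) V = 1 := by
    rw [conjTranspose_registerTensor, registerTensor_mul, hV, Matrix.conjTranspose_one, one_mul,
      ← pauli_zero (p := p), ← pauli_zero (p := p), ← pauli_sumElim, Sum.elim_zero_zero,
      pauli_zero]
  have hs' : registerTensor (pauli p a b) (s • (1 : Op F κ)) =
      s • pauli p (Sum.elim a (0 : κ → F)) (Sum.elim b (0 : κ → F)) := by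
    rw [pauli_sumElim, pauli_zero]
    ext z w
    simp only [registerTensor_apply, Matrix.smul_apply, smul_eq_mul]
    ring
  refine ⟨s * r, ?_⟩
  rintro _ ⟨u, hu, rfl⟩ _ ⟨v, hv, rfl⟩
  rw [encodeRight_eq_mulVec, encodeRight_eq_mulVec, star_mulVec_dotProduct_mulVec hR1,
    Matrix.star_mulVec, ← Matrix.dotProduct_mulVec, Matrix.mulVec_mulVec, Matrix.mulVec_mulVec,
    Matrix.mul_assoc, pauli_sumElim, hR, hE, hs', Matrix.smul_mulVec, dotProduct_smul, hr u hu v hv,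
    smul_eq_mul, mul_assoc]

/-- A code that annihilates every nontrivial error on the receiver's qudits is produced by an
encoding of the sender: the receiver's reduced operators are maximally mixed, so that a
rescaled orthonormal basis of the code is an isometry on the sender's side. -/
theorem exists_eaEncode {n k c : ℕ} {Q : Submodule ℂ (State F (Fin n ⊕ Fin c))}
    (hdim : Module.finrank ℂ Q = Fintype.card F ^ k)
    (h : ∀ e : PhaseSpace F (Fin c), e ≠ 0 → ∀ u ∈ Q, ∀ v ∈ Q,
      star u ⬝ᵥ (pauli p (Sum.elim (0 : Fin n → F) e.1) (Sum.elim (0 : Fin n → F) e.2) *ᵥ v) = 0) :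
    ∃ W : Matrix (Fin n → F) ((Fin k → F) × (Fin c → F)) ℂ,
      Wᴴ * W = 1 ∧ Q = LinearMap.range (eaEncode W) := by
  obtain ⟨M, hM, hMQ⟩ := exists_isometry_onto (Y := Fin k → F) Q (by simpa using hdim)
  have hcol : ∀ i, (fun z => M z i) ∈ Q := by
    intro i
    rw [← hMQ]
    exact ⟨Pi.single i 1, by funext z; simp⟩
  have hone : ∀ i j, ∑ z, star (M z i) * M z j = if i = j then 1 else 0 := by
    intro i j
    simpa [Matrix.mul_apply, Matrix.one_apply] using congrFun (congrFun hM i) j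
  -- The reduced operators of the receiver, as the errors on that side determine them.
  have hred : ∀ i j x y, ∑ z, star (M (Sum.elim z x) i) * M (Sum.elim z y) j =
      if x = y then (if i = j then 1 else 0) / (Fintype.card (Fin c → F) : ℂ) else 0 := by
    intro i j
    refine eq_of_sum_mul_pauli p (fun x y => ∑ z, star (M (Sum.elim z x) i) * M (Sum.elim z y) j)
      _ fun e => ?_
    have key : star (fun z => M z i) ⬝ᵥ (pauli p (Sum.elim (0 : Fin n → F) e.1)
        (Sum.elim (0 : Fin n → F) e.2) *ᵥ fun z => M z j) =
        ∑ x, ∑ y, (∑ z, star (M (Sum.elim z x) i) * M (Sum.elim z y) j) *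
          pauli p e.1 e.2 x y := by
      rw [pauli_sumElim, pauli_zero, ← encodeRight_eq_mulVec]
      simp only [dotProduct, sum_sumElim, encodeRight, LinearMap.coe_mk, AddHom.coe_mk,
        Sum.elim_comp_inl, Sum.elim_comp_inr, Pi.star_apply, Finset.sum_mul, Finset.mul_sum]
      rw [Finset.sum_comm]
      refine Finset.sum_congr rfl fun x _ => ?_
      rw [Finset.sum_comm]
      refine Finset.sum_congr rfl fun y _ => Finset.sum_congr rfl fun z _ => ?_
      ring
    rw [← key]
    by_cases he : e = 0
    · simp only [he, Prod.fst_zero, Prod.snd_zero, Sum.elim_zero_zero, pauli_zero,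
        Matrix.one_mulVec, if_true, ← hone i j]
      rfl
    · rw [if_neg he]
      exact h e he _ (hcol i) _ (hcol j)
  have hq : (0 : ℝ) < (Fintype.card F : ℝ) ^ c := by
    have : 0 < Fintype.card F := Fintype.card_pos
    positivity
  have hs0 : ((Real.sqrt ((Fintype.card F : ℝ) ^ c) : ℝ) : ℂ) ≠ 0 := by
    exact_mod_cast (Real.sqrt_pos.mpr hq).ne'
  have hs2 : ((Real.sqrt ((Fintype.card F : ℝ) ^ c) : ℝ) : ℂ) *
      ((Real.sqrt ((Fintype.card F : ℝ) ^ c) : ℝ) : ℂ) = (Fintype.card (Fin c → F) : ℂ) := by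
    rw [← Complex.ofReal_mul, Real.mul_self_sqrt hq.le]
    simp
  -- The factor `q ^ (c / 2)` makes up for the norm of the entangled pairs.
  refine ⟨Matrix.of fun x iy => ((Real.sqrt ((Fintype.card F : ℝ) ^ c) : ℝ) : ℂ) *
    M (Sum.elim x iy.2) iy.1, ?_, ?_⟩
  · ext ⟨i, x⟩ ⟨j, y⟩
    have h1 : ∀ z, star (((Real.sqrt ((Fintype.card F : ℝ) ^ c) : ℝ) : ℂ) * M (Sum.elim z x) i) *
        (((Real.sqrt ((Fintype.card F : ℝ) ^ c) : ℝ) : ℂ) * M (Sum.elim z y) j) =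
        (Fintype.card (Fin c → F) : ℂ) * (star (M (Sum.elim z x) i) * M (Sum.elim z y) j) := by
      intro z
      rw [← hs2, star_mul', Complex.star_def, Complex.conj_ofReal]
      ring
    simp only [Matrix.mul_apply, Matrix.conjTranspose_apply, Matrix.of_apply, h1,
      ← Finset.mul_sum, hred, Matrix.one_apply, Prod.mk.injEq]
    have hc0 : (Fintype.card (Fin c → F) : ℂ) ≠ 0 := by exact_mod_cast Fintype.card_ne_zero
    by_cases hx : x = y <;> by_cases hi : i = j <;> simp only [hx, hi, if_true, if_false, and_true,
      and_false, mul_zero, zero_div]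
    rw [mul_one_div_cancel hc0]
  · rw [← hMQ]
    congr 1
    refine LinearMap.ext fun ψ => funext fun z => ?_
    simp only [Matrix.mulVecLin_apply, Matrix.mulVec, dotProduct, eaEncode, LinearMap.coe_mk,
      AddHom.coe_mk, Matrix.of_apply, ebits]
    refine Finset.sum_congr rfl fun i _ => ?_
    rw [Finset.sum_eq_single (z ∘ Sum.inr)]
    · rw [if_pos rfl, Sum.elim_comp_inl_inr]
      field_simp
    · intro x _ hx; simp [hx]
    · simp

end Encodings

/-! ### Extension of the stabilizer by the receiver's qudits -/

section Extension

variable {p : ℕ} [Fact p.Prime] {F ι κ : Type} [Field F] [Fintype F] [DecidableEq F]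
  [Algebra (ZMod p) F] [Fintype ι] [DecidableEq ι] [Fintype κ] [DecidableEq κ]

variable (p F ι κ) in
/-- The label `(v, w)` of a tensor product of two Pauli operators, as a label for the composite
register. -/
def joinPhase : PhaseSpace F ι × PhaseSpace F κ →ₗ[ZMod p] PhaseSpace F (ι ⊕ κ) where
  toFun x := (Sum.elim x.1.1 x.2.1, Sum.elim x.1.2 x.2.2)
  map_add' x y := by ext i <;> rcases i with i | i <;> rfl
  map_smul' r x := by ext i <;> rcases i with i | i <;> rfl

theorem joinPhase_apply (v : PhaseSpace F ι) (w : PhaseSpace F κ) :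
    joinPhase p F ι κ (v, w) = (Sum.elim v.1 w.1, Sum.elim v.2 w.2) := rfl

theorem joinPhase_injective : Function.Injective (joinPhase p F ι κ) := by
  rintro ⟨⟨a, b⟩, a', b'⟩ ⟨⟨c, d⟩, c', d'⟩ h
  simp only [joinPhase_apply, Prod.mk.injEq, Sum.elim_eq_iff] at h
  simp [h]

theorem traceForm_joinPhase (v v' : PhaseSpace F ι) (w w' : PhaseSpace F κ) :
    traceForm p F (ι ⊕ κ) (joinPhase p F ι κ (v, w)) (joinPhase p F ι κ (v', w')) =
      traceForm p F ι v v' + traceForm p F κ w w' := by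
  simp only [traceForm_apply, ← map_add, joinPhase_apply, symp, sumElim_dotProduct_sumElim]
  congr 1
  ring

theorem natCard_phaseSpace :
    Nat.card (PhaseSpace F κ) = Fintype.card F ^ (2 * Fintype.card κ) := by
  simp [two_mul, pow_add]

/-- A subspace of phase space that is the sum of its radical `WI` and of a symplectic part `WE` of
the same size as the phase space of `κ` extends to an isotropic subspace: the symplectic part is
joined with its image under an anti-isometry onto the phase space of `κ`. -/
theorem exists_isotropic_extension {WI WE : Submodule (ZMod p) (PhaseSpace F ι)}
    (hII : ∀ v ∈ WI, ∀ w ∈ WI, traceForm p F ι v w = 0)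
    (hIE : ∀ v ∈ WI, ∀ w ∈ WE, traceForm p F ι v w = 0)
    (hEE : ∀ v ∈ WE, (∀ w ∈ WE, traceForm p F ι v w = 0) → v = 0)
    (hdisj : WI ⊓ WE = ⊥)
    (hcard : Nat.card WE = Fintype.card F ^ (2 * Fintype.card κ)) :
    ∃ L : Submodule (ZMod p) (PhaseSpace F (ι ⊕ κ)),
      (∀ x ∈ L, ∀ y ∈ L, traceForm p F (ι ⊕ κ) x y = 0) ∧
      Set.BijOn (fun v => (v.1 ∘ Sum.inl, v.2 ∘ Sum.inl))
        (L : Set (PhaseSpace F (ι ⊕ κ))) (WI ⊔ WE : Submodule (ZMod p) (PhaseSpace F ι)) ∧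
      (∀ v, joinPhase p F ι κ (v, 0) ∈ L ↔ v ∈ WI) ∧
      ∀ e, e ≠ 0 → ∃ x ∈ L, traceForm p F (ι ⊕ κ) (joinPhase p F ι κ (0, e)) x ≠ 0 := by
  have hfr : Module.finrank (ZMod p) WE = Module.finrank (ZMod p) (PhaseSpace F κ) := by
    refine Nat.pow_right_injective (Fact.out : p.Prime).two_le ?_
    have h1 := Module.natCard_eq_pow_finrank (K := ZMod p) (V := WE)
    have h2 := Module.natCard_eq_pow_finrank (K := ZMod p) (V := PhaseSpace F κ)
    rw [Nat.card_zmod] at h1 h2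
    simp only
    rw [← h1, ← h2, hcard, natCard_phaseSpace]
  obtain ⟨φ, hφ'⟩ := exists_symplectic_embedding _ WE (PhaseSpace F κ)
    ((traceForm p F ι).restrict WE) (-traceForm p F κ) (fun v => traceForm_isAlt _)
    (fun v => by simp [traceForm_isAlt v])
    (fun v hv => Subtype.ext (hEE v v.2 fun w hw => hv ⟨w, hw⟩))
    (fun v hv => traceForm_nondegenerate (p := p) fun w => by simpa using hv w) rfl hfr.le
  have hφ : ∀ v w : WE, traceForm p F κ (φ v) (φ w) = - traceForm p F ι v w := fun v w => by
    have h := hφ' v w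
    simp only [LinearMap.neg_apply] at h
    rw [← neg_eq_iff_eq_neg]
    exact h
  have hinj : Function.Injective φ := by
    refine (injective_iff_map_eq_zero φ).mpr fun v hv => Subtype.ext (hEE v v.2 fun w hw => ?_)
    have h := hφ v ⟨w, hw⟩
    rw [hv, map_zero, LinearMap.zero_apply] at h
    exact neg_eq_zero.mp h.symm
  have hsurj : Function.Surjective φ :=
    (LinearMap.injective_iff_surjective_of_finrank_eq_finrank hfr).mp hinj
  let Φ : WI × WE →ₗ[ZMod p] PhaseSpace F (ι ⊕ κ) := (joinPhase p F ι κ).comp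
    ((WI.subtype.coprod WE.subtype).prod (φ.comp (LinearMap.snd _ _ _)))
  have hΦ : ∀ v w, Φ (v, w) = joinPhase p F ι κ ((v : PhaseSpace F ι) + w, φ w) := fun _ _ => rfl
  have hEI : ∀ w ∈ WE, ∀ v ∈ WI, traceForm p F ι w v = 0 := fun w hw v hv => by
    rw [← traceForm_isAlt.neg_eq, hIE v hv w hw, neg_zero]
  -- The sum of the radical and the symplectic part is direct.
  have huniq : ∀ (v v' : WI) (w w' : WE), (v : PhaseSpace F ι) + w = v' + w' →
      v = v' ∧ w = w' := by
    intro v v' w w' h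
    have h1 : ((v - v' : WI) : PhaseSpace F ι) = ((w' - w : WE) : PhaseSpace F ι) := by
      push_cast
      rw [sub_eq_sub_iff_add_eq_add, h, add_comm]
    have h2 : ((v - v' : WI) : PhaseSpace F ι) ∈ WI ⊓ WE := ⟨(v - v').2, h1 ▸ (w' - w).2⟩
    rw [hdisj, Submodule.mem_bot] at h2
    rw [h2] at h1
    exact ⟨sub_eq_zero.mp (Subtype.ext h2), (sub_eq_zero.mp (Subtype.ext h1.symm)).symm⟩
  refine ⟨LinearMap.range Φ, ?_, ⟨?_, ?_, ?_⟩, fun v => ⟨?_, fun hv => ?_⟩, fun e he => ?_⟩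
  · rintro _ ⟨⟨v, w⟩, rfl⟩ _ ⟨⟨v', w'⟩, rfl⟩
    rw [hΦ, hΦ, traceForm_joinPhase, hφ]
    simp only [map_add, LinearMap.add_apply, hII v v.2 v' v'.2, hIE v v.2 w' w'.2,
      hEI w w.2 v' v'.2]
    ring
  · rintro _ ⟨⟨v, w⟩, rfl⟩
    exact Submodule.add_mem_sup v.2 w.2
  · rintro _ ⟨⟨v, w⟩, rfl⟩ _ ⟨⟨v', w'⟩, rfl⟩ h
    obtain ⟨h1, h2⟩ := huniq v v' w w' h
    rw [h1, h2]
  · intro x hx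
    obtain ⟨v, hv, w, hw, rfl⟩ := Submodule.mem_sup.mp hx
    exact ⟨_, ⟨(⟨v, hv⟩, ⟨w, hw⟩), rfl⟩, rfl⟩
  · rintro ⟨⟨v', w'⟩, h⟩
    rw [hΦ] at h
    have h1 := joinPhase_injective h
    rw [Prod.mk.injEq] at h1
    have h2 : w' = 0 := hinj (h1.2.trans (map_zero φ).symm)
    rw [← h1.1, h2, Submodule.coe_zero, add_zero]
    exact v'.2
  · exact ⟨(⟨v, hv⟩, 0), by simp [hΦ]⟩
  · by_contra! h
    refine he (traceForm_nondegenerate (p := p) fun w => ?_)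
    obtain ⟨w, rfl⟩ := hsurj w
    simpa [hΦ, traceForm_joinPhase] using h _ ⟨(0, w), rfl⟩

end Extension

/-! ### Distances and the combined code -/

section Distances

variable {p : ℕ} [Fact p.Prime] {F ι κ : Type} [Field F] [Fintype F] [DecidableEq F]
  [Algebra (ZMod p) F] [Fintype ι] [DecidableEq ι] [Fintype κ] [DecidableEq κ]

theorem minDist_eq_normDist {Q : Submodule ℂ (State F ι)} {A : Subgroup (Op F ι)ˣ}
    (hA : A ≤ pauliGroup p F ι)
    (h : ∀ e : PhaseSpace F ι, Detects Q (pauli p e.1 e.2) ↔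
      ¬ ((∀ w ∈ tau p A, traceForm p F ι e w = 0) ∧ e ∉ tau p A)) :
    minDist p Q = normDist p A A :=
  iInf_congr fun a => iInf_congr fun b => iInf_congr_Prop
    (by rw [h (a, b), not_not, ← commute_all_iff hA]) fun _ => rfl

theorem minDistLeft_eq_normDist {Q : Submodule ℂ (State F (ι ⊕ κ))} {A B : Subgroup (Op F ι)ˣ}
    (hA : A ≤ pauliGroup p F ι)
    (h : ∀ e : PhaseSpace F ι,
      Detects Q (pauli p (Sum.elim e.1 (0 : κ → F)) (Sum.elim e.2 (0 : κ → F))) ↔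
      ¬ ((∀ w ∈ tau p A, traceForm p F ι e w = 0) ∧ e ∉ tau p B)) :
    minDistLeft p Q = normDist p A B :=
  iInf_congr fun a => iInf_congr fun b => iInf_congr_Prop
    (by rw [h (a, b), not_not, ← commute_all_iff hA]) fun _ => rfl

theorem detects_of_wt_lt_minDist {Q : Submodule ℂ (State F ι)} {a b : ι → F}
    (h : (wt a b : ℕ∞) < minDist p Q) : Detects Q (pauli p a b) := by
  by_contra hd
  exact h.not_ge (iInf_le_of_le a (iInf_le_of_le b (iInf_le_of_le hd le_rfl)))

theorem detects_of_wt_lt_minDistLeft {Q : Submodule ℂ (State F (ι ⊕ κ))} {a b : ι → F}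
    (h : (wt a b : ℕ∞) < minDistLeft p Q) :
    Detects Q (pauli p (Sum.elim a (0 : κ → F)) (Sum.elim b (0 : κ → F))) := by
  by_contra hd
  exact h.not_ge (iInf_le_of_le a (iInf_le_of_le b (iInf_le_of_le hd le_rfl)))

/-- An abelian group of Pauli operators that omits `ω I` stabilizes a code whose distance is that
of the normalizer. -/
theorem isQECC_stabCode {m kb : ℕ} {Sb : Subgroup (Op F (Fin m))ˣ}
    (hSb : Sb ≤ pauliGroup p F (Fin m))
    (homega : ∀ g ∈ Sb, (g : Op F (Fin m)) ≠ omega p • 1)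
    (hkm : kb ≤ m) (hcard : Nat.card Sb = Fintype.card F ^ (m - kb)) :
    IsQECC p m kb (normDist p Sb Sb) (stabCode Sb) := by
  have hχ : FixesPhases p Sb 1 := fun g k hk => by simpa using (phase_eq_one homega g.2 hk).symm
  have hQ : IsEigenCode Sb 1 (stabCode Sb) := fun v =>
    ⟨fun h g => by simpa using h g g.2, fun h g hg => by simpa using h ⟨g, hg⟩⟩
  refine ⟨?_, minDist_eq_normDist hSb (detects_iff hSb hχ hQ)⟩
  have h := finrank_mul_card hSb hχ hQ
  rw [card_tauSubmodule_of_forall_ne hSb homega, hcard, Fintype.card_fin] at h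
  refine Nat.eq_of_mul_eq_mul_right (pow_pos Fintype.card_pos (m - kb)) (h.trans ?_)
  rw [← pow_add, Nat.add_sub_cancel' hkm]

/-- The joint eigenspace of an isotropic extension of `τ(S)` is a code with EA-stabilizer `S`. -/
theorem exists_isEAQECC {n l c : ℕ} {S SI SE : Subgroup (Op F (Fin n))ˣ}
    (hS : S ≤ pauliGroup p F (Fin n)) (hdec : IsDirectProduct p S SI SE)
    (hSI : IsIsotropic p SI) (hSE : IsEntanglement p SE)
    (hcardI : (tau p SI).ncard = Fintype.card F ^ l)
    (hcardE : (tau p SE).ncard = Fintype.card F ^ (2 * c)) :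
    c + l ≤ n ∧ ∃ Q : Submodule ℂ (State F (Fin n ⊕ Fin c)),
      IsEAQECC p n (n - c - l) (normDist p S SI) c Q ∧ EAStabilizes p S Q := by
  have hsup : tauSubmodule p S = tauSubmodule p SI ⊔ tauSubmodule p SE := by
    rw [← hdec.sup_eq]
    exact tauSubmodule_sup (hdec.sup_eq.le.trans hS)
  have hdisj : tauSubmodule p SI ⊓ tauSubmodule p SE = ⊥ :=
    SetLike.coe_injective hdec.inter
  have hcI : Nat.card (tauSubmodule p SI) = Fintype.card F ^ l := hcardI
  have hcE : Nat.card (tauSubmodule p SE) = Fintype.card F ^ (2 * c) := hcardE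
  have hIE : ∀ v ∈ tauSubmodule p SI, ∀ w ∈ tauSubmodule p SE, traceForm p F (Fin n) v w = 0 :=
    fun v hv w hw => traceForm_eq_zero_of_commute hdec.commute hv hw
  have hII : ∀ v ∈ tauSubmodule p SI, ∀ w ∈ tauSubmodule p SI, traceForm p F (Fin n) v w = 0 :=
    fun v hv w hw => hSI hv w hw
  obtain ⟨L, hiso, hbij, hleft, hright⟩ := exists_isotropic_extension (κ := Fin c) hII hIE
    (fun v hv h => (Set.ext_iff.mp hSE v).mp ⟨hv, h⟩) hdisj (by simpa using hcE)
  rw [← hsup] at hbij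
  have hT := pauliOver_le L
  have hτ := tau_pauliOver L
  obtain ⟨χ, hχ⟩ := exists_fixesPhases hT (pauliOver_commute hiso)
  obtain ⟨Q, hQ⟩ := exists_isEigenCode _ χ
  have hτ' : tauSubmodule p (pauliOver L) = L := SetLike.coe_injective hτ
  have hcL : Nat.card L = Fintype.card F ^ (l + 2 * c) := by
    have h1 : Nat.card L = Nat.card (tauSubmodule p S) := Nat.card_congr (hbij.equiv _)
    have h2 := Submodule.finrank_sup_add_finrank_inf_eq (tauSubmodule p SI) (tauSubmodule p SE)
    rw [hdisj, finrank_bot, add_zero, ← hsup] at h2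
    rw [h1, Module.natCard_eq_pow_finrank (K := ZMod p), h2, pow_add,
      ← Module.natCard_eq_pow_finrank, ← Module.natCard_eq_pow_finrank, hcI, hcE, pow_add]
  have hdim := finrank_mul_card hT hχ hQ
  rw [hτ', hcL, Fintype.card_sum, Fintype.card_fin, Fintype.card_fin] at hdim
  -- The bound on `c + l` is the divisibility of the dimensions of a nonzero code and its space.
  have hle : c + l ≤ n := by
    have h := (Nat.pow_dvd_pow_iff_le_right (Fintype.one_lt_card (α := F))).mp
      (Dvd.intro_left _ hdim)
    omega
  have hdimQ : Module.finrank ℂ Q = Fintype.card F ^ (n - c - l) := by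
    refine Nat.eq_of_mul_eq_mul_right (pow_pos Fintype.card_pos (l + 2 * c)) (hdim.trans ?_)
    rw [← pow_add]
    congr 1
    omega
  refine ⟨hle, Q, ⟨exists_eaEncode (p := p) hdimQ fun e he u hu v hv => ?_,
    minDistLeft_eq_normDist hS fun e => ?_⟩, pauliOver L, hT, pauliOver_commute hiso, ?_, χ, hQ⟩
  · obtain ⟨x, hx, hne⟩ := hright e he
    rw [← SetLike.mem_coe, ← hτ] at hx
    obtain ⟨g, hg, k, hk⟩ := hx
    exact dotProduct_mulVec_eq_zero hk hne ((hQ u).mp hu ⟨g, hg⟩) ((hQ v).mp hv ⟨g, hg⟩)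
  · have h := detects_iff hT hχ hQ (joinPhase p F (Fin n) (Fin c) (e, 0))
    rw [hτ, SetLike.mem_coe, hleft] at h
    refine h.trans (not_congr (and_congr_left' ?_))
    have hform : ∀ x : PhaseSpace F (Fin n ⊕ Fin c),
        traceForm p F (Fin n ⊕ Fin c) (joinPhase p F (Fin n) (Fin c) (e, 0)) x =
          traceForm p F (Fin n) e (x.1 ∘ Sum.inl, x.2 ∘ Sum.inl) := by
      intro x
      have hx : x = joinPhase p F (Fin n) (Fin c)
          ((x.1 ∘ Sum.inl, x.2 ∘ Sum.inl), (x.1 ∘ Sum.inr, x.2 ∘ Sum.inr)) := by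
        simp [joinPhase_apply]
      conv_lhs => rw [hx]
      rw [traceForm_joinPhase, map_zero, LinearMap.zero_apply, add_zero]
    constructor
    · intro h w hw
      obtain ⟨x, hx, rfl⟩ := hbij.surjOn hw
      rw [← hform]
      exact h x hx
    · intro h x hx
      rw [hform]
      exact h _ (hbij.mapsTo hx)
  · rw [hτ]
    exact hbij

end Distances

end QCode

end

theorem theorem3 (p : ℕ) [Fact p.Prime] (F : Type) [Field F] [Fintype F] [DecidableEq F]
    [Algebra (ZMod p) F] (n m l c kb : ℕ)
    (S SI SE : Subgroup (QCode.Op F (Fin n))ˣ) (Sb : Subgroup (QCode.Op F (Fin m))ˣ)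
    (hS : S ≤ QCode.pauliGroup p F (Fin n))
    (hdec : QCode.IsDirectProduct p S SI SE)
    (hSI : QCode.IsIsotropic p SI) (hSE : QCode.IsEntanglement p SE)
    (hcardI : (QCode.tau p SI).ncard = Fintype.card F ^ l)
    (hcardE : (QCode.tau p SE).ncard = Fintype.card F ^ (2 * c))
    (hSb : Sb ≤ QCode.pauliGroup p F (Fin m))
    (hab : ∀ g ∈ Sb, ∀ h ∈ Sb, g * h = h * g)
    (homega : ∀ g ∈ Sb, (g : QCode.Op F (Fin m)) ≠ QCode.omega p • 1)
    (hkm : kb ≤ m) (hcardb : Nat.card Sb = Fintype.card F ^ (m - kb))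
    (hc : c ≤ kb) :
    c + l ≤ n ∧
      ∃ (Qea : Submodule ℂ (QCode.State F (Fin n ⊕ Fin c)))
        (Qb : Submodule ℂ (QCode.State F (Fin m)))
        (QC : Submodule ℂ (QCode.State F (Fin n ⊕ Fin m))),
        QCode.IsCombination p S Sb (n - c - l) (QCode.normDist p S SI) kb
          (QCode.normDist p Sb Sb) Qea Qb QC := by
  obtain ⟨hle, Q, hQ, hstab⟩ := QCode.exists_isEAQECC hS hdec hSI hSE hcardI hcardE
  have hb := QCode.isQECC_stabCode hSb homega hkm hcardb
  obtain ⟨V, hV, hVQ⟩ := QCode.exists_isometry (Y := Fin c → F) (QCode.stabCode Sb) (by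
    rw [hb.dim, Fintype.card_fun, Fintype.card_fin]
    exact Nat.pow_le_pow_right Fintype.card_pos hc)
  refine ⟨hle, Q, QCode.stabCode Sb, _, hQ, hstab, hb, rfl, hc, ⟨V, hV, hVQ, rfl⟩, ?_⟩
  intro a b a' b' h h'
  rw [← hQ.dist] at h
  rw [← hb.dist] at h'
  exact QCode.detects_map_encodeRight hV hVQ (QCode.detects_of_wt_lt_minDistLeft h)
    (QCode.detects_of_wt_lt_minDist h')
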